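/- Let $\mathfrak g$ be a simple finite-dimensional Lie algebra over $\mathbb C$, $\mathfrak h$ a Cartan subalgebra with root system $\Delta$, $G_0=\{h_1,\dots,h_r\}$ a basis of $\mathfrak h$, and $e_\alpha\in\mathfrak g_\alpha\setminus\{0\}$ for $\alpha\in\Delta$. Let $U_0(\mathfrak g)$ be the centralizer of $\mathfrak h$ in $U(\mathfrak g)$. A nonempty finite list (multiset) of roots with sum $0$ is called indecomposable if it is not the disjoint union of two nonempty lists with sum $0$. Fix a total order on $\Delta$. The perfect monomials of degree greater than one are the products $e_{\alpha_1}e_{\alpha_2}\cdots e_{\alpha_n}\in U_0(\mathfrak g)$ with $\alpha_1\le\dots\le\alpha_n$ and $(\alpha_1,\dots,\alpha_n)$ indecomposable; let $d_0$ be the maximal length $n$ of such a list. Let $J$ be a set of indeterminates $c_p$, one for each such perfect monomial $p$, and let $\omega:\mathbb C\langle J\cup G_0\rangle\to U(\mathfrak g)$ be the homomorphism from the free associative algebra with $\omega(c_p)=p$ and $\omega(h_i)=h_i$. Put $K=\ker\omega$, the ideal of relations. Fix a total order on $J\cup G_0$. For a monomial $Y$ in $J\cup G_0$ let $T_1(Y)$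 be the set of monomials $X$ in $J\cup G_0$ such that, when each $c_p$ is replaced by the word $p$, the resulting words in the $h_i$ and $e_\alpha$ are permutations of each other. Call $Y$ semi-perfect if it is the lexicographically smallest element of $T_1(Y)$. A normal form $\mathcal N(x)$ of $x\in U_0(\mathfrak g)$ is a linear combination of semi-perfect monomials in $\mathbb C\langle J\cup G_0\rangle$ whose image under $\omega$ is $x$; for a monomial $w$ write $\mathcal N(w)=\mathcal N(\omega(w))$. Then: 1. There are only finitely many indecomposable lists, so $J$ is finite and $d_0$ is well defined; the image of $\omega$ is $U_0(\mathfrak g)$; every $x\in U_0(\mathfrak g)$ has exactly one normal form. 2. Modulo the relations $h_ig=gh_i$ ($1\le i\le r$, $g\in J\cup G_0$), which say that the $h_i$ are central, the ideal $K$ is generated by $K'=\{c_{1}\cdots c_{m}-\mathcal N(c_{1}\cdots c_{m})\mid m\le d_0,\ c_1,\dots,c_m\in J\}$. That is, $K$ is the two-sided ideal generated by $K'$ and these commutation relations. Equivalently, $K$ is the two-sided ideal generated by all relations $g_1\cdots g_m-\mathcal N(g_1\cdots g_m)$ of length $m\le d_0$ with $g_1,\dots,g_m\in J\cup G_0$.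 3. Consequently $U_0(\mathfrak g)$ is finitely generated and finitely presented as an associative algebra. -/

import Mathlib

namespace CartanCentralizer

noncomputable section

section Roots

variable {L : Type*} [LieRing L] [LieAlgebra ℂ L] [FiniteDimensional ℂ L]
  (H : LieSubalgebra ℂ L) [H.IsCartanSubalgebra]

/-- The set `Δ` of roots of `(L, H)` (the nonzero weights of `H` on `L`), as a type. -/
abbrev Root : Type _ := {α : LieModule.Weight ℂ H L // α ∈ H.root}

variable {H}

/-- The weight of a list of roots (as an unordered list, that is, a multiset): the sum of its
entries, as a function on `H`. -/
def weight (s : Multiset (Root H)) : H → ℂ :=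
  (s.map fun α => (α.1 : H → ℂ)).sum

/-- `s` is a zero-weight indecomposable list of roots: it is nonempty of weight zero, and it is
not the disjoint union of two nonempty lists of weight zero. -/
def IsIndecomposable (s : Multiset (Root H)) : Prop :=
  s ≠ 0 ∧ weight s = 0 ∧
    ¬ ∃ s₁ s₂ : Multiset (Root H),
      s₁ ≠ 0 ∧ s₂ ≠ 0 ∧ weight s₁ = 0 ∧ weight s₂ = 0 ∧ s = s₁ + s₂

variable (H) in
/-- The maximal degree `d₀` of a perfect monomial of degree greater than one, that is, the
maximal length of a zero-weight indecomposable list of roots. -/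
def maxDegree : ℕ :=
  sSup {n | ∃ s : Multiset (Root H), IsIndecomposable s ∧ Multiset.card s = n}

variable (H) in
/-- The perfect monomials `e_{α₁} ⋯ e_{αₙ}` of degree greater than one, recorded as the list
`(α₁, …, αₙ)`: ordered lists `α₁ ≤ ⋯ ≤ αₙ` of roots that are zero-weight indecomposable. -/
abbrev PerfectList [LinearOrder (Root H)] : Type _ :=
  {l : List (Root H) // IsIndecomposable (l : Multiset (Root H)) ∧ l.Pairwise (· ≤ ·)}

variable (H) in
/-- The indeterminates of the presentation: one `h i` for each element of the basis of `H`
(the set `G₀`), and one `c p` for each perfect monomial `p` of degree greater than one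
(the set `J`). -/
inductive Gen (ι : Type*) [LinearOrder (Root H)] : Type _
  | h (i : ι) : Gen ι
  | c (p : PerfectList H) : Gen ι

variable {ι : Type*} [LinearOrder (Root H)]

/-- The letters, in the basis `G = G₀ ∪ G₁` of `L`, of the perfect monomial named by an
indeterminate. The letter `inl i` stands for `h i`, the letter `inr α` stands for `e α`. -/
def Gen.letters : Gen H ι → List (ι ⊕ Root H)
  | .h i => [Sum.inl i]
  | .c p => p.1.map Sum.inr

/-- The monomial in the basis of `L` that is obtained from a monomial `X` in the indeterminates
by substituting the perfect monomials. -/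
def expand (X : List (Gen H ι)) : List (ι ⊕ Root H) :=
  X.flatMap Gen.letters

/-- The set `T₁(Y)` of all monomials `X` in the indeterminates whose expansion is a permutation
of the expansion of `Y`. -/
def T₁ (Y : List (Gen H ι)) : Set (List (Gen H ι)) :=
  {X | (expand X).Perm (expand Y)}

/-- Lexicographic order: `X < Y` if, at the first place where they differ, the letter of `X` is
smaller than the letter of `Y`. -/
def LexLT [LinearOrder (Gen H ι)] (X Y : List (Gen H ι)) : Prop :=
  ∃ (p u v : List (Gen H ι)) (a b : Gen H ι), X = p ++ a :: u ∧ Y = p ++ b :: v ∧ a < b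

/-- `Y` is semi-perfect: it is the minimal element of `T₁(Y)` in the lexicographic order. -/
def IsSemiPerfect [LinearOrder (Gen H ι)] (Y : List (Gen H ι)) : Prop :=
  ∀ X ∈ T₁ Y, ¬ LexLT X Y

/-- The monomial, in the free associative algebra on the indeterminates, spelled by a list. -/
def word (X : List (Gen H ι)) : FreeAlgebra ℂ (Gen H ι) :=
  (X.map (FreeAlgebra.ι ℂ)).prod

variable (b : Module.Basis ι ℂ H) (e : Root H → L)

/-- A letter of the basis `G = G₀ ∪ G₁`, as an element of `U(L)`. -/
def letterValue : ι ⊕ Root H → UniversalEnvelopingAlgebra ℂ L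
  | .inl i => UniversalEnvelopingAlgebra.ι ℂ (b i : L)
  | .inr α => UniversalEnvelopingAlgebra.ι ℂ (e α)

/-- The homomorphism `ω` from the free associative algebra on the indeterminates to `U(L)` that
sends each indeterminate to its perfect monomial. -/
def omega : FreeAlgebra ℂ (Gen H ι) →ₐ[ℂ] UniversalEnvelopingAlgebra ℂ L :=
  FreeAlgebra.lift ℂ fun g => (g.letters.map (letterValue b e)).prod

/-- `n` is a normal form of `x ∈ U(L)`: a linear combination of semi-perfect monomials with
value `x`. -/
def IsNormalForm [LinearOrder (Gen H ι)] (x : UniversalEnvelopingAlgebra ℂ L)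
    (n : FreeAlgebra ℂ (Gen H ι)) : Prop :=
  n ∈ Submodule.span ℂ (word '' {Y : List (Gen H ι) | IsSemiPerfect Y}) ∧ omega b e n = x

/-- The relations `g₁ ⋯ gₘ - 𝒩(g₁ ⋯ gₘ)` of length `m ≤ d₀`, where the letters `g₁, …, gₘ` are
taken from the set `A` of indeterminates and `𝒩` is the normal form. -/
def shortRelations [LinearOrder (Gen H ι)] (A : Set (Gen H ι)) :
    Set (FreeAlgebra ℂ (Gen H ι)) :=
  {r | ∃ (X : List (Gen H ι)) (n : FreeAlgebra ℂ (Gen H ι)),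
    X.length ≤ maxDegree H ∧ (∀ g ∈ X, g ∈ A) ∧
      IsNormalForm b e (omega b e (word X)) n ∧ r = word X - n}

variable (H ι) in
/-- The relations saying that each `h i` is central. -/
def centralRelations : Set (FreeAlgebra ℂ (Gen H ι)) :=
  {r | ∃ (i : ι) (g : Gen H ι), r = word [.h i, g] - word [g, .h i]}

end Roots

/-- The Cartan centralizer `U₀(L)`: the centralizer of `H` in `U(L)`. -/
def cartanCentralizer {L : Type*} [LieRing L] [LieAlgebra ℂ L] (H : LieSubalgebra ℂ L) :
    Subalgebra ℂ (UniversalEnvelopingAlgebra ℂ L) :=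
  Subalgebra.centralizer ℂ (UniversalEnvelopingAlgebra.ι ℂ '' (H : Set L))

/-- An associative algebra is finitely presented if it is the quotient of a free associative
algebra on finitely many generators by a two-sided ideal generated by finitely many elements. -/
def IsFinitelyPresented (A : Type*) [Ring A] [Algebra ℂ A] : Prop :=
  ∃ (n : ℕ) (f : FreeAlgebra ℂ (Fin n) →ₐ[ℂ] A) (R : Finset (FreeAlgebra ℂ (Fin n))),
    Function.Surjective f ∧
      TwoSidedIdeal.ker f = TwoSidedIdeal.span (R : Set (FreeAlgebra ℂ (Fin n)))

end

end CartanCentralizer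

/-! Weigh a word in the generators by the number of letters in its expansion; call this its degree.
Commuting two letters of the basis of `L` changes a product only by shorter products of the same
weight. Hence, in the enveloping algebra, words with the same letters up to order agree modulo lower
degree, and a zero-weight product of letters reduces by induction to semi-perfect words: a
zero-weight list always splits into Cartan letters and indecomposable lists. Distinct semi-perfect
words have distinct multisets of letters, so their images are independent by the part of
Poincaré–Birkhoff–Witt in `linearIndependent_listProd`. This gives existence and uniqueness of
normal forms.

For the relations, let `I` be the ideal generated by the proposed ones. It suffices that every word
is congruent modulo `I` to a combination of semi-perfect words, because `omega` is injective on
these (`ker_omega_le`). The core is `word_sub_word_mem_degreeLT`. If the semi-perfect form of `X`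
begins with `c p`, the letters of `p` occur in at most `|p| ≤ d₀` factors of `X`, all in `J`. Modulo
lower degree these factors can be brought together and replaced, by one short relation, with their
semi-perfect form. Minimality on both sides forces that form to begin with `c p`; the tail follows
by induction. Finiteness of the presentation then comes from Gordan's lemma. -/

namespace CartanCentralizer

open TensorProduct

attribute [local instance] LieRing.ofAssociativeRing

/-! ### Independence of monomials in the enveloping algebra, through the coproduct -/

section Monomials

variable {K L σ : Type*} [Field K] [LieRing L] [LieAlgebra K L]

/-- The comultiplication of the universal enveloping algebra, for which `L` is primitive. -/
noncomputable def comul :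
    UniversalEnvelopingAlgebra K L →ₐ[K]
      UniversalEnvelopingAlgebra K L ⊗[K] UniversalEnvelopingAlgebra K L :=
  UniversalEnvelopingAlgebra.lift K
    { toFun := fun x => UniversalEnvelopingAlgebra.ι K x ⊗ₜ 1 +
        1 ⊗ₜ UniversalEnvelopingAlgebra.ι K x
      map_add' := fun x y => by
        simp only [map_add, TensorProduct.add_tmul, TensorProduct.tmul_add]; abel
      map_smul' := fun c x => by
        simp only [map_smul, TensorProduct.smul_tmul', TensorProduct.tmul_smul, smul_add,
          RingHom.id_apply]
      map_lie' := fun {x y} => by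
        simp only [LieHom.map_lie, LieRing.of_associative_ring_bracket, mul_add, add_mul,
          Algebra.TensorProduct.tmul_mul_tmul, one_mul, mul_one, TensorProduct.sub_tmul,
          TensorProduct.tmul_sub]
        abel }

theorem comul_ι (x : L) :
    comul (UniversalEnvelopingAlgebra.ι K x) =
      UniversalEnvelopingAlgebra.ι K x ⊗ₜ 1 + 1 ⊗ₜ UniversalEnvelopingAlgebra.ι K x :=
  UniversalEnvelopingAlgebra.lift_ι_apply K _ x

/-- The counit of the universal enveloping algebra. -/
noncomputable def counit : UniversalEnvelopingAlgebra K L →ₐ[K] K :=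
  UniversalEnvelopingAlgebra.lift K 0

theorem counit_ι (x : L) : counit (UniversalEnvelopingAlgebra.ι K x) = 0 :=
  UniversalEnvelopingAlgebra.lift_ι_apply K _ x

/-- The product, in the universal enveloping algebra, of a list of letters. -/
noncomputable def listProd (x : σ → L) (l : List σ) : UniversalEnvelopingAlgebra K L :=
  (l.map fun s => UniversalEnvelopingAlgebra.ι K (x s)).prod

@[simp] theorem listProd_nil (x : σ → L) : (listProd x [] : UniversalEnvelopingAlgebra K L) = 1 :=
  rfl

@[simp] theorem listProd_cons (x : σ → L) (a : σ) (l : List σ) :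
    (listProd x (a :: l) : UniversalEnvelopingAlgebra K L) =
      UniversalEnvelopingAlgebra.ι K (x a) * listProd x l := by
  simp [listProd]

theorem listProd_append (x : σ → L) (l m : List σ) :
    (listProd x (l ++ m) : UniversalEnvelopingAlgebra K L) = listProd x l * listProd x m := by
  simp [listProd]

/-- All the ways of removing one entry from a list: pairs of the entry and the remaining list. -/
def removals : List σ → List (σ × List σ)
  | [] => []
  | a :: l => (a, l) :: (removals l).map fun p => (p.1, a :: p.2)

theorem removals_map_fst (l : List σ) : (removals l).map Prod.fst = l := by
  induction l with
  | nil => rfl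
  | cons a l ih => simpa [removals, Function.comp_def] using ih

theorem perm_of_mem_removals {l : List σ} {p : σ × List σ} (h : p ∈ removals l) :
    l.Perm (p.1 :: p.2) := by
  induction l generalizing p with
  | nil => simp [removals] at h
  | cons a l ih =>
    simp only [removals, List.mem_cons, List.mem_map] at h
    rcases h with rfl | ⟨q, hq, rfl⟩
    · rfl
    · exact ((ih hq).cons a).trans (List.Perm.swap _ _ _)

/-- Expanding the product of the primitive elements `x a ⊗ 1 + 1 ⊗ x a` distributes the letters over
the two tensor factors. The terms with no letter or one letter on the left are explicit; all others
have lost at least two letters on the right. -/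
theorem comul_listProd_sub_mem (x : σ → L) (l : List σ) :
    comul (listProd x l) - (1 ⊗ₜ[K] listProd x l +
        ((removals l).map fun p =>
          UniversalEnvelopingAlgebra.ι K (x p.1) ⊗ₜ[K] listProd x p.2).sum) ∈
      Submodule.span K {t | ∃ (u : UniversalEnvelopingAlgebra K L) (m : List σ),
        m.length + 2 ≤ l.length ∧ t = u ⊗ₜ[K] listProd x m} := by
  induction l with
  | nil => simp [removals, Algebra.TensorProduct.one_def]
  | cons a l ih =>
    set R := ((removals l).map fun p =>
          UniversalEnvelopingAlgebra.ι K (x p.1) ⊗ₜ[K] listProd (K := K) x p.2).sum with hR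
    set D := comul (listProd x l) - (1 ⊗ₜ[K] listProd x l + R) with hD
    have hc : comul (K := K) (listProd x l) = D + (1 ⊗ₜ[K] listProd x l + R) := by rw [hD]; abel
    set ia := UniversalEnvelopingAlgebra.ι K (x a) with hia
    have hR2 : (((removals l).map fun p => (p.1, a :: p.2)).map fun p =>
          UniversalEnvelopingAlgebra.ι K (x p.1) ⊗ₜ[K] listProd x p.2).sum =
          (1 ⊗ₜ[K] ia) * R := by
      rw [hR, ← List.sum_map_mul_left, List.map_map]
      congr 1
      refine List.map_congr_left fun p _ => ?_
      simp [hia]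
    have key : comul (listProd x (a :: l)) - (1 ⊗ₜ[K] listProd x (a :: l) +
        ((removals (a :: l)).map fun p =>
          UniversalEnvelopingAlgebra.ι K (x p.1) ⊗ₜ[K] listProd x p.2).sum) =
        (ia ⊗ₜ 1) * D + (1 ⊗ₜ ia) * D + (ia ⊗ₜ 1) * R := by
      simp only [removals, List.map_cons, List.sum_cons, hR2]
      have hca : comul ia = ia ⊗ₜ[K] 1 + 1 ⊗ₜ[K] ia := comul_ι (x a)
      simp only [listProd_cons, map_mul, hc, ← hia, hca]
      simp only [add_mul, mul_add, Algebra.TensorProduct.tmul_mul_tmul, one_mul, mul_one]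
      abel
    rw [key]
    have hmul : ∀ (u : UniversalEnvelopingAlgebra K L) (b : List σ), b.length ≤ 1 →
        (u ⊗ₜ[K] listProd x b) * D ∈
        Submodule.span K {t | ∃ (u : UniversalEnvelopingAlgebra K L) (m : List σ),
          m.length + 2 ≤ (a :: l).length ∧ t = u ⊗ₜ[K] listProd x m} := by
      intro u b hb
      have := Submodule.mem_map_of_mem (f := LinearMap.mulLeft K (u ⊗ₜ[K] listProd x b)) ih
      rw [Submodule.map_span] at this
      refine Submodule.span_mono ?_ this
      rintro _ ⟨_, ⟨v, m, hm, rfl⟩, rfl⟩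
      refine ⟨u * v, b ++ m, ?_, ?_⟩
      · simp; omega
      · simp [listProd_append]
    refine add_mem (add_mem ?_ ?_) ?_
    · simpa using hmul ia [] (by simp)
    · simpa [hia] using hmul 1 [a] (by simp)
    · rw [hR, ← List.sum_map_mul_left]
      refine list_sum_mem ?_
      intro t ht
      obtain ⟨p, hp, rfl⟩ := List.mem_map.1 ht
      refine Submodule.subset_span ⟨ia * UniversalEnvelopingAlgebra.ι K (x p.1), p.2, ?_, ?_⟩
      · have := (perm_of_mem_removals hp).length_eq
        simp at this ⊢; omega
      · simp

/-- Only the removals of a copy of `j` contribute, and what they leave is a permutation of `J`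
exactly when `l` is one of `j :: J`. The number of such removals is the multiplicity of `j` in `l`.
-/
theorem sum_removals_eq [DecidableEq σ] (j : σ) (J l : List σ) (f : List σ → K) (c : K)
    (hf : ∀ m, m.length + 1 = l.length → f m = open Classical in if m.Perm J then c else 0) :
    ((removals l).map fun p => (if p.1 = j then 1 else 0) * f p.2).sum =
      open Classical in if l.Perm (j :: J) then l.count j * c else 0 := by
  classical
  have h : ∀ p ∈ removals l, (if p.1 = j then 1 else 0) * f p.2 =
      (if p.1 = j then 1 else 0) * (if l.Perm (j :: J) then c else 0) := by
    intro p hp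
    have hperm := perm_of_mem_removals hp
    rw [hf p.2 (by simpa using hperm.length_eq.symm)]
    by_cases hj : p.1 = j
    · have : p.2.Perm J ↔ l.Perm (j :: J) := by
        rw [hperm.congr_left, hj, List.perm_cons]
      simp [this]
    · simp [hj]
  rw [List.map_congr_left h, List.sum_map_mul_right]
  have hcount : ((removals l).map fun p => if p.1 = j then (1 : K) else 0).sum = l.count j := by
    have h2 : ((removals l).map fun p => if p.1 = j then (1 : K) else 0) =
        l.map fun s => if s = j then (1 : K) else 0 := by
      conv_rhs => rw [← removals_map_fst l, List.map_map]
      rfl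
    rw [h2]
    clear hf h h2
    induction l with
    | nil => simp
    | cons a l ih =>
      simp only [List.map_cons, List.sum_cons, ih, List.count_cons]
      by_cases ha : a = j <;> simp [ha, add_comm]
  rw [hcount]
  split_ifs <;> simp

/-- If the letters have dual functionals vanishing at `1`, then for every list `J` of letters there
is a functional that tests, for products of at most `|J|` letters, whether the factors are those
of `J`, up to order. -/
theorem exists_functional [CharZero K] [DecidableEq σ] (x : σ → L)
    (φ : σ → UniversalEnvelopingAlgebra K L →ₗ[K] K) (h1 : ∀ j, φ j 1 = 0)
    (hφ : ∀ j k, φ j (UniversalEnvelopingAlgebra.ι K (x k)) = if k = j then 1 else 0)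
    (J : List σ) :
    ∃ (Φ : UniversalEnvelopingAlgebra K L →ₗ[K] K) (c : K), c ≠ 0 ∧
      ∀ l : List σ, l.length ≤ J.length →
        Φ (listProd x l) = open Classical in if l.Perm J then c else 0 := by
  induction J with
  | nil =>
    refine ⟨counit.toLinearMap, 1, one_ne_zero, fun l hl => ?_⟩
    obtain rfl : l = [] := by simpa using hl
    simp
  | cons j J ih =>
    obtain ⟨Ψ, c, hc, hΨ⟩ := ih
    let T : UniversalEnvelopingAlgebra K L ⊗[K] UniversalEnvelopingAlgebra K L →ₗ[K] K :=
      LinearMap.mul' K K ∘ₗ TensorProduct.map (φ j) Ψ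
    have hT : ∀ u v, T (u ⊗ₜ v) = φ j u * Ψ v := fun u v => by simp [T]
    -- The functional is `(φ j ⊗ Ψ) ∘ Δ`, which splits off one letter `j` and tests the rest with
    -- `Ψ`. The constant gains a positive multiplicity, nonzero in characteristic zero.
    refine ⟨T ∘ₗ comul.toLinearMap, (List.count j (j :: J) : K) * c, ?_, fun l hl => ?_⟩
    · refine mul_ne_zero ?_ hc
      simp only [List.count_cons_self]
      exact Nat.cast_ne_zero.2 (Nat.succ_ne_zero _)
    -- `Ψ` vanishes on products that are too short, and this kills the uncontrolled terms of the
    -- coproduct.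
    have hnp : ∀ m : List σ, m.length < J.length → Ψ (listProd x m) = 0 := fun m hm => by
      rw [hΨ m hm.le, if_neg fun h => hm.ne h.length_eq]
    have hD := comul_listProd_sub_mem (K := K) x l
    have hD0 : ∀ t ∈ Submodule.span K {t | ∃ (u : UniversalEnvelopingAlgebra K L) (m : List σ),
        m.length + 2 ≤ l.length ∧ t = u ⊗ₜ[K] listProd x m}, T t = 0 := by
      intro t ht
      induction ht using Submodule.span_induction with
      | mem t ht =>
        obtain ⟨u, m, hm, rfl⟩ := ht
        rw [hT, hnp m (by simp at hl; omega), mul_zero]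
      | zero => simp
      | add a b _ _ ha hb => rw [map_add, ha, hb, add_zero]
      | smul r a _ ha => rw [map_smul, ha, smul_zero]
    have := hD0 _ hD
    rw [map_sub, sub_eq_zero, map_add, hT, h1, zero_mul, zero_add, map_list_sum,
      List.map_map] at this
    simp only [LinearMap.comp_apply, AlgHom.toLinearMap_apply]
    rw [this]
    have h2 : ((removals l).map (T ∘ fun p =>
        UniversalEnvelopingAlgebra.ι K (x p.1) ⊗ₜ[K] listProd x p.2)) =
        (removals l).map fun p => (if p.1 = j then 1 else 0) * Ψ (listProd x p.2) :=
      List.map_congr_left fun p _ => by rw [Function.comp_apply, hT, hφ]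
    rw [h2, sum_removals_eq j J l (fun m => Ψ (listProd x m)) c]
    · by_cases hp : l.Perm (j :: J)
      · simp only [if_pos hp, hp.count_eq]
      · simp only [if_neg hp]
    · intro m hm
      exact hΨ m (by simp at hl; omega)

/-- A faithful adjoint representation keeps the letters independent in `Module.End K L`; coordinate
functionals there pull back to the enveloping algebra. -/
theorem exists_dual_functionals [DecidableEq σ] (had : Function.Injective (LieAlgebra.ad K L))
    (x : σ → L) (hx : LinearIndependent K x) :
    ∃ φ : σ → UniversalEnvelopingAlgebra K L →ₗ[K] K, (∀ j, φ j 1 = 0) ∧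
      ∀ j k, φ j (UniversalEnvelopingAlgebra.ι K (x k)) = if k = j then 1 else 0 := by
  let A := UniversalEnvelopingAlgebra.lift K (LieAlgebra.ad K L)
  have hA : ∀ y, A (UniversalEnvelopingAlgebra.ι K y) = LieAlgebra.ad K L y :=
    UniversalEnvelopingAlgebra.lift_ι_apply K _
  have hlin : LinearIndependent K fun s => LieAlgebra.ad K L (x s) :=
    hx.map' (LieAlgebra.ad K L : L →ₗ[K] Module.End K L) (LinearMap.ker_eq_bot.2 had)
  have hex : ∀ j, ∃ f : Module.End K L →ₗ[K] K, ∀ k,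
      f (LieAlgebra.ad K L (x k)) = if k = j then 1 else 0 := by
    intro j
    obtain ⟨g, hg⟩ := (Finsupp.linearCombination K fun s => LieAlgebra.ad K L (x s)
      ).exists_leftInverse_of_injective (LinearMap.ker_eq_bot.2 hlin)
    refine ⟨Finsupp.lapply j ∘ₗ g, fun k => ?_⟩
    have := DFunLike.congr_fun hg (Finsupp.single k 1)
    simp only [LinearMap.comp_apply, Finsupp.linearCombination_single, one_smul,
      LinearMap.id_apply] at this
    simp only [LinearMap.comp_apply, this, Finsupp.lapply_apply, Finsupp.single_apply]
  choose f hf using hex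
  -- The counit is `1` at `1` and `0` on `L`, so this correction affects only the value at `1`.
  refine ⟨fun j => f j ∘ₗ A.toLinearMap - f j 1 • counit.toLinearMap, fun j => ?_, fun j k => ?_⟩
  · simp
  · simp only [LinearMap.sub_apply, LinearMap.comp_apply, AlgHom.toLinearMap_apply, hA, hf,
      LinearMap.smul_apply, counit_ι, smul_zero, sub_zero]

/-- Products of lists of letters that are pairwise not permutations of each other are linearly
independent: the part of the Poincaré–Birkhoff–Witt theorem that is needed here. -/
theorem linearIndependent_listProd [CharZero K] (had : Function.Injective (LieAlgebra.ad K L))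
    (x : σ → L) (hx : LinearIndependent K x) {τ : Type*} (w : τ → List σ)
    (hw : ∀ s t, (w s).Perm (w t) → s = t) :
    LinearIndependent K fun t => (listProd x (w t) : UniversalEnvelopingAlgebra K L) := by
  classical
  obtain ⟨φ, h1, hφ⟩ := exists_dual_functionals had x hx
  rw [linearIndependent_iff]
  intro f hf
  by_contra hne
  -- The functional of `exists_functional` is controlled only up to the length of its list, so a
  -- longest list in the support is tested.
  obtain ⟨t, ht, hmax⟩ := f.support.exists_max_image (fun t => (w t).length)
    (Finsupp.support_nonempty_iff.2 hne)
  obtain ⟨Φ, c, hc, hΦ⟩ := exists_functional x φ h1 hφ (w t)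
  have h0 := congrArg Φ hf
  rw [Finsupp.linearCombination_apply, Finsupp.sum, map_sum, map_zero,
    Finset.sum_eq_single_of_mem t ht] at h0
  · rw [map_smul, hΦ _ le_rfl, if_pos (List.Perm.refl _), smul_eq_mul] at h0
    exact (mul_ne_zero (Finsupp.mem_support_iff.1 ht) hc) h0
  · intro s hs hst
    rw [map_smul, hΦ _ (hmax s hs), if_neg fun h => hst (hw _ _ h), smul_zero]

/-! ### Reordering and spanning by products of letters, graded by weight -/

section Weights

variable {A : Type*} [AddCommMonoid A] (x : σ → L) (wt : σ → A)

/-- The weight of a list of letters. -/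
def listWeight (l : List σ) : A :=
  (l.map wt).sum

@[simp] theorem listWeight_nil : listWeight wt [] = 0 := rfl

@[simp] theorem listWeight_cons (a : σ) (l : List σ) :
    listWeight wt (a :: l) = wt a + listWeight wt l := by
  simp [listWeight]

theorem listWeight_append (l m : List σ) :
    listWeight wt (l ++ m) = listWeight wt l + listWeight wt m := by
  simp [listWeight]

variable {wt} in
theorem listWeight_perm {l m : List σ} (h : l.Perm m) : listWeight wt l = listWeight wt m :=
  (h.map wt).sum_eq

variable (K) in
/-- The span of the products of less than `n` letters with total weight `χ`. -/
noncomputable def weightSpan (χ : A) (n : ℕ) : Submodule K (UniversalEnvelopingAlgebra K L) :=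
  Submodule.span K {u | ∃ l : List σ, listWeight wt l = χ ∧ l.length < n ∧ u = listProd x l}

variable {wt x}

theorem weightSpan_mono {χ : A} {m n : ℕ} (h : m ≤ n) :
    weightSpan K x wt χ m ≤ weightSpan K x wt χ n := by
  refine Submodule.span_mono ?_
  rintro _ ⟨l, h1, h2, rfl⟩
  exact ⟨l, h1, h2.trans_le h, rfl⟩

theorem ι_mul_mem_weightSpan {χ : A} {n : ℕ} (a : σ) {u : UniversalEnvelopingAlgebra K L}
    (hu : u ∈ weightSpan K x wt χ n) :
    UniversalEnvelopingAlgebra.ι K (x a) * u ∈ weightSpan K x wt (wt a + χ) (n + 1) := by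
  have := Submodule.mem_map_of_mem (f := LinearMap.mulLeft K
    (UniversalEnvelopingAlgebra.ι K (x a))) hu
  rw [weightSpan, Submodule.map_span] at this
  refine Submodule.span_mono ?_ this
  rintro _ ⟨_, ⟨l, h1, h2, rfl⟩, rfl⟩
  exact ⟨a :: l, by simp [h1], by simpa using h2, by simp⟩

/-- Reordering a product of letters changes it by shorter products of the same weight. -/
theorem listProd_sub_mem_of_perm
    (hx : ∀ a b, ⁅x a, x b⁆ ∈ Submodule.span K (x '' {c | wt c = wt a + wt b}))
    {l m : List σ} (h : l.Perm m) :
    (listProd x l - listProd x m : UniversalEnvelopingAlgebra K L) ∈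
      weightSpan K x wt (listWeight wt l) l.length := by
  induction h with
  | nil => simp
  | cons a _ ih =>
    simpa [mul_sub] using ι_mul_mem_weightSpan a ih
  | swap a b l =>
    have hb : (listProd x (b :: a :: l) - listProd x (a :: b :: l) :
        UniversalEnvelopingAlgebra K L) =
        UniversalEnvelopingAlgebra.ι K ⁅x b, x a⁆ * listProd x l := by
      simp [LieHom.map_lie, LieRing.of_associative_ring_bracket, sub_mul, mul_assoc,
        -UniversalEnvelopingAlgebra.ι_apply]
    rw [hb]
    have := Submodule.mem_map_of_mem (f := LinearMap.mulRight K (listProd x l) ∘ₗ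
      (UniversalEnvelopingAlgebra.ι K (L := L)).toLinearMap) (hx b a)
    rw [Submodule.map_span] at this
    refine Submodule.span_mono ?_ this
    rintro _ ⟨_, ⟨c, hc, rfl⟩, rfl⟩
    refine ⟨c :: l, ?_, by simp, by simp⟩
    simp only [Set.mem_ofPred_eq] at hc
    simp [hc, add_assoc]
  | trans h1 _ ih1 ih2 =>
    rw [← listWeight_perm h1, ← h1.length_eq] at ih2
    simpa using add_mem ih1 ih2

theorem span_listProd_eq_top (hx : Submodule.span K (Set.range x) = ⊤) :
    Submodule.span K (Set.range fun l : List σ =>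
      (listProd x l : UniversalEnvelopingAlgebra K L)) = ⊤ := by
  set S := Algebra.adjoin K (Set.range fun s => UniversalEnvelopingAlgebra.ι K (x s)) with hS
  have hι : ∀ y : L, UniversalEnvelopingAlgebra.ι K y ∈ S := by
    intro y
    have hy : y ∈ Submodule.span K (Set.range x) := hx ▸ Submodule.mem_top
    induction hy using Submodule.span_induction with
    | mem y hy => obtain ⟨s, rfl⟩ := hy; exact Algebra.subset_adjoin ⟨s, rfl⟩
    | zero => rw [map_zero]; exact S.zero_mem
    | add a b _ _ ha hb => rw [map_add]; exact S.add_mem ha hb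
    | smul r a _ ha => rw [map_smul]; exact S.smul_mem ha r
  let g : L →ₗ⁅K⁆ S :=
    { toFun := fun y => ⟨UniversalEnvelopingAlgebra.ι K y, hι y⟩
      map_add' := fun a b => Subtype.ext (map_add _ a b)
      map_smul' := fun r a => Subtype.ext (map_smul _ r a)
      map_lie' := fun {a b} => Subtype.ext (LieHom.map_lie _ a b) }
  have hid : S.val.comp (UniversalEnvelopingAlgebra.lift K g) = AlgHom.id K _ := by
    refine UniversalEnvelopingAlgebra.hom_ext K (LieHom.ext fun y => ?_)
    change S.val (UniversalEnvelopingAlgebra.lift K g (UniversalEnvelopingAlgebra.ι K y)) = _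
    rw [UniversalEnvelopingAlgebra.lift_ι_apply]
    rfl
  rw [eq_top_iff]
  intro u _
  have hu : u ∈ S := by
    have := DFunLike.congr_fun hid u
    change ((UniversalEnvelopingAlgebra.lift K g u : S) : UniversalEnvelopingAlgebra K L) = u
      at this
    exact this ▸ Subtype.property _
  rw [← Subalgebra.mem_toSubmodule, hS, Algebra.adjoin_eq_span] at hu
  refine Submodule.span_mono ?_ hu
  intro v hv
  obtain ⟨l, hl, rfl⟩ := Submonoid.exists_list_of_mem_closure hv
  clear hv hu
  induction l with
  | nil => exact ⟨[], rfl⟩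
  | cons a l ih =>
    obtain ⟨m, hm⟩ := ih fun y hy => hl y (List.mem_cons_of_mem _ hy)
    obtain ⟨s, hs⟩ := hl a List.mem_cons_self
    exact ⟨s :: m, by simp only [listProd_cons, hm, List.prod_cons]; rw [← hs]⟩

end Weights

end Monomials

end CartanCentralizer

namespace CartanCentralizer

/-! ### Indecomposable lists, coverings and semi-perfect monomials -/

section Combinatorics

variable {L : Type*} [LieRing L] [LieAlgebra ℂ L] [FiniteDimensional ℂ L]
  {H : LieSubalgebra ℂ L} [H.IsCartanSubalgebra] {ι : Type*}

theorem weight_add (s t : Multiset (Root H)) : weight (s + t) = weight s + weight t := by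
  simp [weight]

theorem IsIndecomposable.eq_of_le {s t : Multiset (Root H)} (hs : IsIndecomposable s)
    (ht : IsIndecomposable t) (h : s ≤ t) : s = t := by
  obtain ⟨u, rfl⟩ := Multiset.le_iff_exists_add.1 h
  by_contra hne
  refine ht.2.2 ⟨s, u, hs.1, ?_, hs.2.1, ?_, rfl⟩
  · rintro rfl
    simp at hne
  · simpa [weight_add, hs.2.1] using ht.2.1

/-- Gordan's lemma: there are finitely many indecomposable lists of roots. -/
theorem finite_isIndecomposable : {s : Multiset (Root H) | IsIndecomposable s}.Finite := by
  classical
  let S := {s : Multiset (Root H) | IsIndecomposable s}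
  let f : Multiset (Root H) → (Root H → ℕ) := fun s α => s.count α
  have hle : ∀ s t, f s ≤ f t → s ≤ t := fun s t h => Multiset.le_iff_count.2 h
  have hinj : Function.Injective f := fun s t h =>
    le_antisymm (hle _ _ h.le) (hle _ _ h.ge)
  have hanti : IsAntichain (· ≤ ·) (f '' S) := by
    rintro _ ⟨s, hs, rfl⟩ _ ⟨t, ht, rfl⟩ hne hst
    exact hne (congrArg f (IsIndecomposable.eq_of_le hs ht (hle _ _ hst)))
  -- Dickson's lemma: `Root H → ℕ` is well-quasi-ordered because `Root H` is finite.
  have hfin : (f '' S).Finite := by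
    exact WellQuasiOrderedLE.finite_of_isAntichain hanti
  exact hfin.of_finite_image hinj.injOn

theorem bddAbove_card_isIndecomposable :
    BddAbove {n | ∃ s : Multiset (Root H), IsIndecomposable s ∧ Multiset.card s = n} :=
  (finite_isIndecomposable.image Multiset.card).bddAbove

theorem IsIndecomposable.card_le {s : Multiset (Root H)} (hs : IsIndecomposable s) :
    Multiset.card s ≤ maxDegree H :=
  le_csSup bddAbove_card_isIndecomposable ⟨s, hs, rfl⟩

/-- The weight of a letter. -/
def letterWeight : ι ⊕ Root H → (H → ℂ) :=
  Sum.elim 0 fun α => (α.1 : H → ℂ)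

theorem listWeight_map_inr (l : List (Root H)) :
    listWeight (letterWeight (ι := ι)) (l.map Sum.inr) = weight (l : Multiset (Root H)) := by
  simp [listWeight, weight, letterWeight, Function.comp_def]

variable [LinearOrder (Root H)]

instance : Finite (PerfectList H) :=
  have := (finite_isIndecomposable (H := H)).to_subtype
  Finite.of_injective (fun p => (⟨_, p.2.1⟩ : {s : Multiset (Root H) | IsIndecomposable s}))
    fun p q h => Subtype.ext <| List.Perm.eq_of_pairwise (fun _ _ _ _ => le_antisymm) p.2.2 q.2.2
      (Multiset.coe_eq_coe.1 (congrArg Subtype.val h))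

instance [Finite ι] : Finite (Gen H ι) :=
  Finite.of_surjective (Sum.elim Gen.h Gen.c : ι ⊕ PerfectList H → Gen H ι) fun g => by
    cases g with
    | h i => exact ⟨.inl i, rfl⟩
    | c p => exact ⟨.inr p, rfl⟩

@[simp] theorem expand_nil : expand ([] : List (Gen H ι)) = [] := rfl

@[simp] theorem expand_cons (g : Gen H ι) (X : List (Gen H ι)) :
    expand (g :: X) = g.letters ++ expand X := rfl

@[simp] theorem expand_append (X Y : List (Gen H ι)) :
    expand (X ++ Y) = expand X ++ expand Y := by
  simp [expand]

theorem expand_perm {X Y : List (Gen H ι)} (h : X.Perm Y) : (expand X).Perm (expand Y) :=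
  h.flatMap_right _

theorem Gen.letters_ne_nil (g : Gen H ι) : g.letters ≠ [] := by
  cases g with
  | h i => simp [Gen.letters]
  | c p =>
    have := p.2.1.1
    simpa [Gen.letters] using this

theorem length_le_length_expand (X : List (Gen H ι)) : X.length ≤ (expand X).length := by
  induction X with
  | nil => simp
  | cons g X ih =>
    have := List.length_pos_iff.2 g.letters_ne_nil
    simp
    omega

theorem eq_nil_of_expand_eq_nil {X : List (Gen H ι)} (h : expand X = []) : X = [] := by
  have := length_le_length_expand X
  simpa [h] using this

theorem listWeight_letters (g : Gen H ι) : listWeight letterWeight g.letters = 0 := by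
  cases g with
  | h i => simp [Gen.letters, letterWeight]
  | c p => rw [Gen.letters, listWeight_map_inr, p.2.1.2.1]

theorem listWeight_expand (X : List (Gen H ι)) : listWeight letterWeight (expand X) = 0 := by
  induction X with
  | nil => rfl
  | cons g X ih => rw [expand_cons, listWeight_append, listWeight_letters, ih, add_zero]

/-- The perfect monomial of an indecomposable multiset of roots. -/
theorem exists_gen_of_isIndecomposable {s : Multiset (Root H)} (hs : IsIndecomposable s) :
    ∃ p : PerfectList H, (p.1 : Multiset (Root H)) = s :=
  ⟨⟨s.sort (· ≤ ·), by rwa [Multiset.sort_eq], s.pairwise_sort (· ≤ ·)⟩, Multiset.sort_eq _ _⟩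

theorem exists_expand_of_weight_eq_zero (s : Multiset (Root H)) (hs : weight s = 0) :
    ∃ X : List (Gen H ι), (expand X : Multiset (ι ⊕ Root H)) = s.map Sum.inr := by
  induction hn : Multiset.card s using Nat.strong_induction_on generalizing s with
  | _ n ih =>
    by_cases h0 : s = 0
    · exact ⟨[], by simp [h0]⟩
    by_cases hi : IsIndecomposable s
    · obtain ⟨p, rfl⟩ := exists_gen_of_isIndecomposable hi
      exact ⟨[.c p], by simp [Gen.letters]⟩
    · obtain ⟨s₁, s₂, h₁, h₂, hw₁, hw₂, rfl⟩ : ∃ s₁ s₂ : Multiset (Root H),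
          s₁ ≠ 0 ∧ s₂ ≠ 0 ∧ weight s₁ = 0 ∧ weight s₂ = 0 ∧ s = s₁ + s₂ := by
        by_contra hcon
        exact hi ⟨h0, hs, hcon⟩
      rw [Multiset.card_add] at hn
      have c₁ := Multiset.card_pos.2 h₁
      have c₂ := Multiset.card_pos.2 h₂
      obtain ⟨X₁, hX₁⟩ := ih _ (by omega) s₁ hw₁ rfl
      obtain ⟨X₂, hX₂⟩ := ih _ (by omega) s₂ hw₂ rfl
      exact ⟨X₁ ++ X₂, by rw [expand_append, ← Multiset.coe_add, hX₁, hX₂, Multiset.map_add]⟩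

theorem exists_expand_perm (l : List (ι ⊕ Root H)) (hl : listWeight letterWeight l = 0) :
    ∃ X : List (Gen H ι), (expand X).Perm l := by
  have key : ∃ (X : List (Gen H ι)) (s : List (Root H)),
      (expand X ++ s.map Sum.inr).Perm l := by
    clear hl
    induction l with
    | nil => exact ⟨[], [], by simp⟩
    | cons a l ih =>
      obtain ⟨X, s, h⟩ := ih
      cases a with
      | inl i => exact ⟨.h i :: X, s, by simpa [Gen.letters] using h⟩
      | inr α =>
        refine ⟨X, α :: s, ?_⟩
        rw [List.map_cons]
        exact List.perm_middle.trans (h.cons _)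
  obtain ⟨X, s, h⟩ := key
  rw [← listWeight_perm h, listWeight_append, listWeight_expand, zero_add,
    listWeight_map_inr] at hl
  obtain ⟨Y, hY⟩ := exists_expand_of_weight_eq_zero (ι := ι) _ hl
  refine ⟨X ++ Y, ?_⟩
  rw [Multiset.map_coe, Multiset.coe_eq_coe] at hY
  rw [expand_append]
  exact (hY.append_left _).trans h

/-- A list of letters contained in the expansion of a monomial `X` is contained in the expansion of
a part of `X` that has at most as many factors, each of them sharing a letter with it. -/
theorem exists_sublist_covering (X : List (Gen H ι)) (t : Multiset (ι ⊕ Root H))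
    (ht : t ≤ (expand X : Multiset (ι ⊕ Root H))) :
    ∃ Z : List (Gen H ι), Z.Sublist X ∧ Z.length ≤ Multiset.card t ∧
      (∀ g ∈ Z, ∃ a ∈ g.letters, a ∈ t) ∧ t ≤ (expand Z : Multiset (ι ⊕ Root H)) := by
  classical
  induction X generalizing t with
  | nil => exact ⟨[], by simp, by simp, by simp, ht⟩
  | cons g X ih =>
    rw [expand_cons, ← Multiset.coe_add] at ht
    by_cases hg : ∃ a ∈ g.letters, a ∈ t
    · obtain ⟨Z, hZ, hlen, hmeet, hle⟩ := ih (t - g.letters) (tsub_le_iff_left.2 ht)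
      refine ⟨g :: Z, hZ.cons_cons g, ?_, ?_, ?_⟩
      · obtain ⟨a, ha, hat⟩ := hg
        -- Each retained factor uses up at least one letter of `t`, which bounds the number of
        -- retained factors.
        have hlt : t - g.letters < t := by
          refine lt_of_le_of_ne tsub_le_self fun h => ?_
          have h1 := congrArg (Multiset.count a) h
          rw [Multiset.count_sub] at h1
          have h2 := Multiset.count_pos.2 hat
          have h3 : 0 < Multiset.count a (g.letters : Multiset (ι ⊕ Root H)) :=
            Multiset.count_pos.2 (by simpa using ha)
          omega
        have := Multiset.card_lt_card hlt
        simp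
        omega
      · intro g' hg'
        rcases List.mem_cons.1 hg' with rfl | hg'
        · exact hg
        · obtain ⟨a, ha, hat⟩ := hmeet g' hg'
          exact ⟨a, ha, Multiset.mem_of_le tsub_le_self hat⟩
      · rw [expand_cons, ← Multiset.coe_add]
        exact tsub_le_iff_left.1 hle
    · have hle : t ≤ (expand X : Multiset (ι ⊕ Root H)) := by
        rw [Multiset.le_iff_count] at ht ⊢
        intro a
        by_cases hat : a ∈ t
        · have h1 := ht a
          have h2 : a ∉ (g.letters : Multiset (ι ⊕ Root H)) := fun h =>
            hg ⟨a, by simpa using h, hat⟩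
          rwa [Multiset.count_add, Multiset.count_eq_zero_of_notMem h2, zero_add] at h1
        · rw [Multiset.count_eq_zero_of_notMem hat]
          exact Nat.zero_le _
      obtain ⟨Z, hZ, h⟩ := ih t hle
      exact ⟨Z, hZ.cons g, h⟩

/-- The factors of a monomial `X` that cover a perfect monomial `p` contained in `X`: there are at
most as many as `p` has letters, and they can be chosen in `J`. -/
theorem exists_perm_append_of_perm_cons (p : PerfectList H) {X W : List (Gen H ι)}
    (h : (expand X).Perm (expand (.c p :: W))) :
    ∃ X₁ X₂ Z : List (Gen H ι), X.Perm (X₁ ++ X₂) ∧ X₁ ≠ [] ∧ X₁.length ≤ maxDegree H ∧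
      (∀ g ∈ X₁, g ∈ Set.range (Gen.c (H := H) (ι := ι))) ∧
      (expand X₁).Perm (expand (.c p :: Z)) := by
  classical
  obtain ⟨X₁, hsub, hlen, hmeet, hle⟩ := exists_sublist_covering X
    (p.1.map Sum.inr : List (ι ⊕ Root H)) (by
      rw [Multiset.coe_eq_coe.2 h, expand_cons, ← Multiset.coe_add]
      exact Multiset.le_add_right _ _)
  obtain ⟨X₂, hX⟩ := hsub.exists_perm_append
  obtain ⟨r, hr⟩ := Multiset.le_iff_exists_add.1 hle
  induction r using Quotient.inductionOn with
  | _ r =>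
  have hr' : (expand X₁).Perm (p.1.map Sum.inr ++ r) := by
    rw [← Multiset.coe_eq_coe, hr, ← Multiset.coe_add]
    rfl
  -- The letters left over from `X₁` after removing `p` still have weight zero, hence are spelled by
  -- some word `Z`.
  have hw : listWeight letterWeight r = 0 := by
    have := listWeight_perm (wt := letterWeight) hr'
    rw [listWeight_expand, listWeight_append, listWeight_map_inr, p.2.1.2.1, zero_add] at this
    exact this.symm
  obtain ⟨Z, hZ⟩ := exists_expand_perm r hw
  have hp0 : p.1 ≠ [] := by simpa using p.2.1.1
  refine ⟨X₁, X₂, Z, hX, ?_, ?_, ?_, ?_⟩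
  · rintro rfl
    simp [hp0] at hr'
  · refine hlen.trans ?_
    simpa using p.2.1.card_le
  · intro g hg
    -- A retained factor shares a letter with `p`, whose letters are all roots; this excludes `h i`.
    obtain ⟨a, ha, hat⟩ := hmeet g hg
    cases g with
    | c q => exact ⟨q, rfl⟩
    | h i =>
      simp [Gen.letters] at ha
      simp [ha] at hat
  · exact hr'.trans (hZ.symm.append_left _)

variable [LinearOrder (Gen H ι)]

theorem LexLT.lt {X Y : List (Gen H ι)} (h : LexLT X Y) : X < Y := by
  obtain ⟨p, u, v, a, b, rfl, rfl, hab⟩ := h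
  induction p with
  | nil => exact List.Lex.rel hab
  | cons c p ih => exact List.Lex.cons ih

theorem LexLT.cons {X Y : List (Gen H ι)} (g : Gen H ι) (h : LexLT X Y) :
    LexLT (g :: X) (g :: Y) := by
  obtain ⟨p, u, v, a, b, rfl, rfl, hab⟩ := h
  exact ⟨g :: p, u, v, a, b, rfl, rfl, hab⟩

theorem LexLT.of_lt {a b : Gen H ι} (h : a < b) (X Y : List (Gen H ι)) :
    LexLT (a :: X) (b :: Y) :=
  ⟨[], X, Y, a, b, rfl, rfl, h⟩

theorem exists_isSemiPerfect [Finite ι] (X : List (Gen H ι)) :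
    ∃ Y : List (Gen H ι), IsSemiPerfect Y ∧ (expand Y).Perm (expand X) := by
  -- Every generator has at least one letter, so words with a given expansion up to order have
  -- bounded length over a finite alphabet.
  have hfin : (T₁ X).Finite :=
    (List.finite_length_le (Gen H ι) (expand X).length).subset fun Y (hY : List.Perm _ _) =>
      (length_le_length_expand Y).trans hY.length_eq.le
  obtain ⟨Y, hY, hmin⟩ := Set.exists_min_image _ id hfin ⟨X, List.Perm.refl _⟩
  exact ⟨Y, fun Z hZ hlt => hlt.lt.not_ge (hmin Z (List.Perm.trans hZ hY)), hY⟩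

/-- `LexLT` does not compare a word with its proper prefixes, but these have fewer letters and so
cannot lie in the same class. -/
theorem eq_or_lexLT_of_expand_perm {X Y : List (Gen H ι)} (h : (expand X).Perm (expand Y)) :
    X = Y ∨ LexLT X Y ∨ LexLT Y X := by
  induction X generalizing Y with
  | nil => exact .inl (eq_nil_of_expand_eq_nil h.symm.eq_nil).symm
  | cons a X ih =>
    cases Y with
    | nil => exact .inl (eq_nil_of_expand_eq_nil h.eq_nil)
    | cons b Y =>
      rcases lt_trichotomy a b with hab | rfl | hab
      · exact .inr (.inl (.of_lt hab _ _))
      · rcases ih ((List.perm_append_left_iff _).1 h) with rfl | h | h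
        · exact .inl rfl
        · exact .inr (.inl (h.cons a))
        · exact .inr (.inr (h.cons a))
      · exact .inr (.inr (.of_lt hab _ _))

theorem IsSemiPerfect.eq_of_perm {X Y : List (Gen H ι)} (hX : IsSemiPerfect X)
    (hY : IsSemiPerfect Y) (h : (expand X).Perm (expand Y)) : X = Y := by
  rcases eq_or_lexLT_of_expand_perm h with h' | h' | h'
  · exact h'
  · exact absurd h' (hY X h)
  · exact absurd h' (hX Y h.symm)

theorem IsSemiPerfect.of_cons {g : Gen H ι} {Y : List (Gen H ι)} (h : IsSemiPerfect (g :: Y)) :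
    IsSemiPerfect Y := fun X hX hlt =>
  h (g :: X) (List.Perm.append_left g.letters hX) (hlt.cons g)

end Combinatorics

end CartanCentralizer

namespace CartanCentralizer

/-! ### The basis of `L` made of Cartan elements and root vectors -/

section RootSpaces

variable {L : Type*} [LieRing L] [LieAlgebra ℂ L] [FiniteDimensional ℂ L]
  {H : LieSubalgebra ℂ L} [H.IsCartanSubalgebra] {ι : Type*}
  (b : Module.Basis ι ℂ H) (e : Root H → L)

/-- A letter, as an element of the Lie algebra. -/
noncomputable def letterVector : ι ⊕ Root H → L :=
  Sum.elim (fun i => (b i : L)) e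

variable {e}

theorem letterVector_mem_rootSpace
    (he : ∀ α : Root H, e α ∈ LieAlgebra.rootSpace H α.1 ∧ e α ≠ 0) (a : ι ⊕ Root H) :
    letterVector b e a ∈ LieAlgebra.rootSpace H (letterWeight a) := by
  cases a with
  | inl i =>
    have : (b i : L) ∈ H.toLieSubmodule := (b i).2
    rw [← LieAlgebra.rootSpace_zero_eq ℂ L H] at this
    exact this
  | inr α => exact (he α).1

theorem linearIndependent_letterVector
    (he : ∀ α : Root H, e α ∈ LieAlgebra.rootSpace H α.1 ∧ e α ≠ 0) : LinearIndependent ℂ (letterVector b e) := by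
  have hind := LieModule.iSupIndep_genWeightSpace ℂ H L
  have hind' : iSupIndep fun χ : H → ℂ => (LieModule.genWeightSpace L χ).toSubmodule := by
    simpa [LieSubmodule.iSupIndep_toSubmodule] using hind
  have hinj : Function.Injective fun α : Root H => (α.1 : H → ℂ) :=
    fun α β h => Subtype.ext (DFunLike.coe_injective h)
  have he' : LinearIndependent ℂ e :=
    (hind'.comp hinj).linearIndependent _ (fun α => (he α).1) fun α => (he α).2
  have hb' : LinearIndependent ℂ fun i => (b i : L) :=
    b.linearIndependent.map' H.toSubmodule.subtype (Submodule.ker_subtype _)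
  refine hb'.sum_type he' ?_
  refine (hind' 0).mono ?_ ?_
  · rw [Submodule.span_le]
    rintro _ ⟨i, rfl⟩
    exact letterVector_mem_rootSpace b he (.inl i)
  · rw [Submodule.span_le]
    rintro _ ⟨α, rfl⟩
    have hne : (α.1 : H → ℂ) ≠ 0 := H.isNonZero_coe_root α
    exact Submodule.mem_iSup_of_mem (α.1 : H → ℂ) (Submodule.mem_iSup_of_mem hne (he α).1)

variable [LieAlgebra.IsSimple ℂ L]

theorem mem_span_letterVector
    (he : ∀ α : Root H, e α ∈ LieAlgebra.rootSpace H α.1 ∧ e α ≠ 0) {χ : H → ℂ} {y : L} (hy : y ∈ LieAlgebra.rootSpace H χ) :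
    y ∈ Submodule.span ℂ (letterVector b e '' {c | letterWeight c = χ}) := by
  by_cases hχ : χ = 0
  · subst hχ
    rw [LieAlgebra.rootSpace_zero_eq ℂ L H] at hy
    have hyH : y ∈ H := hy
    have := Submodule.mem_map_of_mem (f := H.toSubmodule.subtype) (b.mem_span ⟨y, hyH⟩)
    rw [Submodule.map_span] at this
    refine Submodule.span_mono ?_ this
    rintro _ ⟨_, ⟨i, rfl⟩, rfl⟩
    exact ⟨.inl i, rfl, rfl⟩
  · by_cases hbot : LieAlgebra.rootSpace H χ = ⊥
    · rw [hbot, LieSubmodule.mem_bot] at hy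
      rw [hy]
      exact zero_mem _
    · let α : LieModule.Weight ℂ H L := ⟨χ, hbot⟩
      have hα : α.IsNonZero := fun h => hχ h
      have hmem : α ∈ H.root := by simpa [LieSubalgebra.root] using hα
      have hfr := LieAlgebra.IsKilling.finrank_rootSpace_eq_one α hα
      obtain ⟨h1, h2⟩ := he ⟨α, hmem⟩
      obtain ⟨c, hc⟩ := (finrank_eq_one_iff_of_nonzero'
        (⟨e ⟨α, hmem⟩, h1⟩ : LieAlgebra.rootSpace H α) (by simpa using h2)).1 hfr ⟨y, hy⟩
      have hc' : c • e ⟨α, hmem⟩ = y := congrArg Subtype.val hc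
      rw [← hc']
      exact Submodule.smul_mem _ _ (Submodule.subset_span ⟨.inr ⟨α, hmem⟩, rfl, rfl⟩)

theorem lie_letterVector_mem
    (he : ∀ α : Root H, e α ∈ LieAlgebra.rootSpace H α.1 ∧ e α ≠ 0) (a c : ι ⊕ Root H) :
    ⁅letterVector b e a, letterVector b e c⁆ ∈ Submodule.span ℂ
      (letterVector b e '' {d | letterWeight d = letterWeight a + letterWeight c}) :=
  mem_span_letterVector b he <| LieAlgebra.lie_mem_genWeightSpace_of_mem_genWeightSpace
    (letterVector_mem_rootSpace b he a) (letterVector_mem_rootSpace b he c)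

theorem lie_coe_letterVector
    (he : ∀ α : Root H, e α ∈ LieAlgebra.rootSpace H α.1 ∧ e α ≠ 0) (h : H) (a : ι ⊕ Root H) :
    ⁅(h : L), letterVector b e a⁆ = letterWeight a h • letterVector b e a :=
  LieAlgebra.IsKilling.lie_eq_smul_of_mem_rootSpace (letterVector_mem_rootSpace b he a) h

theorem span_letterVector
    (he : ∀ α : Root H, e α ∈ LieAlgebra.rootSpace H α.1 ∧ e α ≠ 0) : Submodule.span ℂ (Set.range (letterVector b e)) = ⊤ := by
  have htop := congrArg LieSubmodule.toSubmodule
    (LieModule.iSup_genWeightSpace_eq_top' ℂ H L)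
  rw [LieSubmodule.iSup_toSubmodule, LieSubmodule.top_toSubmodule] at htop
  rw [eq_top_iff, ← htop, iSup_le_iff]
  intro α y hy
  exact Submodule.span_mono (Set.image_subset_range _ _) (mem_span_letterVector b he hy)

/-- Without roots `L` would equal `H`, which is abelian. -/
theorem nonempty_root (b : Module.Basis ι ℂ H)
    (he : ∀ α : Root H, e α ∈ LieAlgebra.rootSpace H α.1 ∧ e α ≠ 0) : Nonempty (Root H) := by
  by_contra hemp
  rw [not_nonempty_iff] at hemp
  have hH : ∀ y : L, y ∈ H := fun y => by
    have hy : y ∈ Submodule.span ℂ (Set.range (letterVector b e)) :=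
      span_letterVector b he ▸ Submodule.mem_top
    refine (Submodule.span_le (p := H.toSubmodule)).2 ?_ hy
    rintro _ ⟨a | α, rfl⟩
    · exact (b a).2
    · exact hemp.elim α
  refine LieAlgebra.IsSimple.non_abelian ℂ (L := L) ⟨fun y z => ?_⟩
  have := trivial_lie_zero H H ⟨y, hH y⟩ ⟨z, hH z⟩
  exact congrArg Subtype.val this

/-- The list `{α, -α}` is indecomposable since no single root has weight zero. The bound lets
relations of length two, hence commutators, count as short. -/
theorem two_le_maxDegree (b : Module.Basis ι ℂ H)
    (he : ∀ α : Root H, e α ∈ LieAlgebra.rootSpace H α.1 ∧ e α ≠ 0) : 2 ≤ maxDegree H := by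
  obtain ⟨α⟩ := nonempty_root b he
  have hne : ∀ β : Root H, (β.1 : H → ℂ) ≠ 0 := fun β => H.isNonZero_coe_root β
  let β : Root H := ⟨-α.1, by
    simpa [LieSubalgebra.root] using LieModule.Weight.IsNonZero.neg (hne α)⟩
  refine IsIndecomposable.card_le (s := {α, β}) ⟨by simp, ?_, ?_⟩
  · simp [weight, β]
  · rintro ⟨s₁, s₂, h₁, h₂, hw₁, -, h⟩
    have hcard := congrArg Multiset.card h
    rw [Multiset.card_add] at hcard
    have c₁ := Multiset.card_pos.2 h₁
    have c₂ := Multiset.card_pos.2 h₂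
    have h₁' : Multiset.card s₁ = 1 := by
      simp at hcard
      omega
    obtain ⟨γ, rfl⟩ := Multiset.card_eq_one.1 h₁'
    refine hne γ ?_
    rwa [weight, Multiset.map_singleton, Multiset.sum_singleton] at hw₁

end RootSpaces

end CartanCentralizer

namespace CartanCentralizer

attribute [local instance] LieRing.ofAssociativeRing

/-! ### The image of `omega` and normal forms -/

section NormalForms

variable {L : Type*} [LieRing L] [LieAlgebra ℂ L] [FiniteDimensional ℂ L]
  {H : LieSubalgebra ℂ L} [H.IsCartanSubalgebra] {ι : Type*}
  (b : Module.Basis ι ℂ H) {e : Root H → L}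

section Word

variable [LinearOrder (Root H)]

@[simp] theorem word_nil : word ([] : List (Gen H ι)) = 1 := rfl

theorem word_cons (g : Gen H ι) (X : List (Gen H ι)) :
    word (g :: X) = word [g] * word X := by
  simp [word]

theorem word_append (X Y : List (Gen H ι)) : word (X ++ Y) = word X * word Y := by
  simp [word]

theorem omega_word (X : List (Gen H ι)) :
    omega b e (word X) = listProd (letterVector b e) (expand X) := by
  have hval : ∀ l : List (ι ⊕ Root H),
      (l.map (letterValue b e)).prod = listProd (letterVector b e) l := fun l => by
    refine congrArg List.prod (List.map_congr_left fun a _ => ?_)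
    cases a <;> rfl
  induction X with
  | nil => simp
  | cons g X ih =>
    rw [word_cons, map_mul, ih, expand_cons, listProd_append]
    simp [word, omega, hval]

theorem span_range_word : Submodule.span ℂ (Set.range (word (H := H) (ι := ι))) = ⊤ := by
  rw [eq_top_iff]
  intro x _
  induction x using FreeAlgebra.induction with
  | grade0 r =>
    rw [Algebra.algebraMap_eq_smul_one]
    exact Submodule.smul_mem _ _ (Submodule.subset_span ⟨[], rfl⟩)
  | grade1 g => exact Submodule.subset_span ⟨[g], by simp [word]⟩
  | mul x y hx hy =>
    have := Submodule.mul_mem_mul (hx trivial) (hy trivial)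
    rw [Submodule.span_mul_span] at this
    refine Submodule.span_mono ?_ this
    rintro _ ⟨_, ⟨X, rfl⟩, _, ⟨Y, rfl⟩, rfl⟩
    exact ⟨X ++ Y, word_append X Y⟩
  | add x y hx hy => exact add_mem (hx trivial) (hy trivial)

variable [LinearOrder (Gen H ι)]

variable (H ι) in
/-- The span of the semi-perfect monomials of degree less than `n`. -/
noncomputable def semiPerfectSpan (n : ℕ) : Submodule ℂ (FreeAlgebra ℂ (Gen H ι)) :=
  Submodule.span ℂ (word '' {Y : List (Gen H ι) | IsSemiPerfect Y ∧ (expand Y).length < n})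

theorem semiPerfectSpan_mono {m n : ℕ} (h : m ≤ n) :
    semiPerfectSpan H ι m ≤ semiPerfectSpan H ι n :=
  Submodule.span_mono (Set.image_mono fun _ hY => ⟨hY.1, hY.2.trans_le h⟩)

theorem semiPerfectSpan_le (n : ℕ) : semiPerfectSpan H ι n ≤
    Submodule.span ℂ (word '' {Y : List (Gen H ι) | IsSemiPerfect Y}) :=
  Submodule.span_mono (Set.image_mono fun _ hY => hY.1)

end Word

variable [LieAlgebra.IsSimple ℂ L]

theorem ι_mul_listProd (he : ∀ α : Root H, e α ∈ LieAlgebra.rootSpace H α.1 ∧ e α ≠ 0)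
    (h : H) (l : List (ι ⊕ Root H)) :
    UniversalEnvelopingAlgebra.ι ℂ (h : L) * listProd (letterVector b e) l =
      listProd (letterVector b e) l * UniversalEnvelopingAlgebra.ι ℂ (h : L) +
        listWeight letterWeight l h • listProd (letterVector b e) l := by
  induction l with
  | nil => simp
  | cons a l ih =>
    have h1 := congrArg (UniversalEnvelopingAlgebra.ι ℂ) (lie_coe_letterVector b he h a)
    rw [LieHom.map_lie, map_smul, LieRing.of_associative_ring_bracket, sub_eq_iff_eq_add] at h1
    rw [listProd_cons, ← mul_assoc, h1, add_mul, mul_assoc, ih, listWeight_cons, Pi.add_apply]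
    simp only [mul_add, mul_assoc, add_smul, smul_mul_assoc, mul_smul_comm]
    abel

theorem listProd_mem_cartanCentralizer
    (he : ∀ α : Root H, e α ∈ LieAlgebra.rootSpace H α.1 ∧ e α ≠ 0)
    {l : List (ι ⊕ Root H)} (hl : listWeight letterWeight l = 0) :
    listProd (letterVector b e) l ∈ cartanCentralizer H := by
  rw [cartanCentralizer, Subalgebra.mem_centralizer_iff]
  rintro _ ⟨h, hh, rfl⟩
  simpa [hl, -UniversalEnvelopingAlgebra.ι_apply] using ι_mul_listProd b he ⟨h, hh⟩ l

/-- An element of the Cartan centralizer is a combination of products of weight zero, because the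
weight spaces are independent. -/
theorem mem_weightSpan_of_mem_cartanCentralizer
    (he : ∀ α : Root H, e α ∈ LieAlgebra.rootSpace H α.1 ∧ e α ≠ 0)
    {x : UniversalEnvelopingAlgebra ℂ L} (hx : x ∈ cartanCentralizer H) :
    ∃ n, x ∈ weightSpan ℂ (letterVector b e) letterWeight 0 n := by
  -- The adjoint action of `H`: a commuting family, so its simultaneous generalized eigenspaces `W`
  -- are independent. Each product of letters lies in the one of its weight, the centralizer in `W
  -- 0`.
  let f : H → Module.End ℂ (UniversalEnvelopingAlgebra ℂ L) := fun h =>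
    LinearMap.mulLeft ℂ (UniversalEnvelopingAlgebra.ι ℂ (h : L)) -
      LinearMap.mulRight ℂ (UniversalEnvelopingAlgebra.ι ℂ (h : L))
  have hf : ∀ h u, f h u = UniversalEnvelopingAlgebra.ι ℂ (h : L) * u -
      u * UniversalEnvelopingAlgebra.ι ℂ (h : L) := fun _ _ => rfl
  have hcomm : ∀ h k : H, Commute (f h) (f k) := fun h k => by
    have hk : UniversalEnvelopingAlgebra.ι ℂ (h : L) * UniversalEnvelopingAlgebra.ι ℂ (k : L) =
        UniversalEnvelopingAlgebra.ι ℂ (k : L) * UniversalEnvelopingAlgebra.ι ℂ (h : L) := by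
      have h0 : ⁅(h : L), (k : L)⁆ = 0 := congrArg Subtype.val (trivial_lie_zero H H h k)
      have := congrArg (UniversalEnvelopingAlgebra.ι ℂ) h0
      rwa [LieHom.map_lie, map_zero, LieRing.of_associative_ring_bracket, sub_eq_zero] at this
    refine LinearMap.ext fun u => ?_
    simp only [Module.End.mul_apply, hf, mul_sub, sub_mul]
    simp only [← mul_assoc, hk]
    simp only [mul_assoc, hk]
    abel
  let W : (H → ℂ) → Submodule ℂ (UniversalEnvelopingAlgebra ℂ L) := fun χ =>
    ⨅ h, (f h).maxGenEigenspace (χ h)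
  have hind : iSupIndep W := Module.End.independent_iInf_maxGenEigenspace_of_forall_mapsTo f
    fun h k φ => Module.End.mapsTo_maxGenEigenspace_of_comm (hcomm k h) φ
  have hW : ∀ χ u, (∀ h, f h u = χ h • u) → u ∈ W χ := fun χ u hu => by
    refine (Submodule.mem_iInf _).2 fun h => ?_
    exact Module.End.mem_maxGenEigenspace _ _ _ |>.2 ⟨1, by simp [hu h]⟩
  have hlW : ∀ l : List (ι ⊕ Root H),
      listProd (letterVector b e) l ∈ W (listWeight letterWeight l) := fun l =>
    hW _ _ fun h => by rw [hf, ι_mul_listProd b he, add_sub_cancel_left]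
  have hxW : x ∈ W 0 := hW _ _ fun h => by
    rw [hf, Pi.zero_apply, zero_smul, sub_eq_zero]
    rw [cartanCentralizer, Subalgebra.mem_centralizer_iff] at hx
    exact hx _ ⟨h, h.2, rfl⟩
  have hdec : ∀ u : UniversalEnvelopingAlgebra ℂ L,
      ∃ n, ∃ y ∈ weightSpan ℂ (letterVector b e) letterWeight 0 n,
        ∃ z ∈ ⨆ χ, ⨆ (_ : χ ≠ 0), W χ, u = y + z := by
    intro u
    have hu : u ∈ Submodule.span ℂ (Set.range fun l : List (ι ⊕ Root H) =>
        (listProd (letterVector b e) l : UniversalEnvelopingAlgebra ℂ L)) :=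
      span_listProd_eq_top (span_letterVector b he) ▸ Submodule.mem_top
    induction hu using Submodule.span_induction with
    | mem u hu =>
      obtain ⟨l, rfl⟩ := hu
      by_cases hl : listWeight letterWeight l = 0
      · exact ⟨l.length + 1, _, Submodule.subset_span ⟨l, hl, Nat.lt_succ_self _, rfl⟩, 0,
          zero_mem _, (add_zero _).symm⟩
      · exact ⟨0, 0, zero_mem _, _, Submodule.mem_iSup_of_mem _
          (Submodule.mem_iSup_of_mem hl (hlW l)), (zero_add _).symm⟩
    | zero => exact ⟨0, 0, zero_mem _, 0, zero_mem _, (add_zero _).symm⟩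
    | add u v _ _ hu hv =>
      obtain ⟨n, y, hy, z, hz, rfl⟩ := hu
      obtain ⟨m, y', hy', z', hz', rfl⟩ := hv
      exact ⟨max n m, y + y', add_mem (weightSpan_mono (le_max_left _ _) hy)
        (weightSpan_mono (le_max_right _ _) hy'), z + z', add_mem hz hz', by abel⟩
    | smul r u _ hu =>
      obtain ⟨n, y, hy, z, hz, rfl⟩ := hu
      exact ⟨n, r • y, Submodule.smul_mem _ _ hy, r • z, Submodule.smul_mem _ _ hz, smul_add _ _ _⟩
  obtain ⟨n, y, hy, z, hz, rfl⟩ := hdec x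
  have hyW : y ∈ W 0 := by
    refine (Submodule.span_le (p := W 0)).2 ?_ hy
    rintro _ ⟨l, hl, -, rfl⟩
    exact hl ▸ hlW l
  -- `z` lies both in `W 0` and in the sum of the other weight spaces.
  have hz0 : z = 0 := by
    refine Submodule.disjoint_def.1 (hind 0) z ?_ hz
    simpa using sub_mem hxW hyW
  exact ⟨n, by simpa [hz0] using hy⟩

variable [LinearOrder (Root H)]

theorem listProd_sub_omega_mem
    (he : ∀ α : Root H, e α ∈ LieAlgebra.rootSpace H α.1 ∧ e α ≠ 0) {l : List (ι ⊕ Root H)}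
    {Y : List (Gen H ι)} (h : (expand Y).Perm l) :
    listProd (letterVector b e) l - omega b e (word Y) ∈
      weightSpan ℂ (letterVector b e) letterWeight 0 l.length := by
  have := listProd_sub_mem_of_perm (lie_letterVector_mem b he) h.symm
  rwa [← listWeight_perm h, listWeight_expand, ← omega_word] at this

theorem omega_mem_cartanCentralizer
    (he : ∀ α : Root H, e α ∈ LieAlgebra.rootSpace H α.1 ∧ e α ≠ 0)
    (x : FreeAlgebra ℂ (Gen H ι)) : omega b e x ∈ cartanCentralizer H := by
  have hx : x ∈ Submodule.span ℂ (Set.range (word (H := H) (ι := ι))) :=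
    by rw [span_range_word]; exact Submodule.mem_top
  induction hx using Submodule.span_induction with
  | mem x hx =>
    obtain ⟨X, rfl⟩ := hx
    rw [omega_word]
    exact listProd_mem_cartanCentralizer b he (listWeight_expand X)
  | zero => rw [map_zero]; exact zero_mem _
  | add x y _ _ hx hy => rw [map_add]; exact add_mem hx hy
  | smul r x _ hx => rw [map_smul]; exact Subalgebra.smul_mem _ hx r

theorem omega_word_comm (he : ∀ α : Root H, e α ∈ LieAlgebra.rootSpace H α.1 ∧ e α ≠ 0)
    (i : ι) (g : Gen H ι) : omega b e (word [.h i, g]) = omega b e (word [g, .h i]) := by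
  have h1 := omega_mem_cartanCentralizer b he (word [g])
  rw [cartanCentralizer, Subalgebra.mem_centralizer_iff] at h1
  have h2 := h1 _ ⟨b i, (b i).2, rfl⟩
  have h3 : omega b e (word [.h i]) = UniversalEnvelopingAlgebra.ι ℂ (b i : L) := by
    rw [omega_word]
    simp [expand, Gen.letters, letterVector]
  rw [word_cons, map_mul, h3, h2, word_cons g [.h i], map_mul, h3]

theorem centralRelations_subset_ker
    (he : ∀ α : Root H, e α ∈ LieAlgebra.rootSpace H α.1 ∧ e α ≠ 0) :
    centralRelations H ι ⊆ TwoSidedIdeal.ker (omega b e) := by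
  rintro _ ⟨i, g, rfl⟩
  refine (TwoSidedIdeal.mem_ker _).2 ?_
  rw [map_sub, omega_word_comm b he, sub_self]

variable [LinearOrder (Gen H ι)]

/-- Induction on degree: a zero-weight product differs from the image of the semi-perfect word with
the same letters by strictly shorter products of weight zero. -/
theorem weightSpan_le_map_semiPerfectSpan
    (he : ∀ α : Root H, e α ∈ LieAlgebra.rootSpace H α.1 ∧ e α ≠ 0) (n : ℕ) :
    weightSpan ℂ (letterVector b e) letterWeight 0 n ≤
      (semiPerfectSpan H ι n).map (omega b e).toLinearMap := by
  have : Finite ι := Module.Finite.finite_basis b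
  induction n using Nat.strong_induction_on with
  | _ n ih =>
    refine Submodule.span_le.2 ?_
    rintro _ ⟨l, hl, hn, rfl⟩
    obtain ⟨X, hX⟩ := exists_expand_perm l hl
    obtain ⟨Y, hY, hYX⟩ := exists_isSemiPerfect X
    have hYl := hYX.trans hX
    have h1 := Submodule.map_mono (f := (omega b e).toLinearMap)
      (semiPerfectSpan_mono hn.le) (ih _ hn (listProd_sub_omega_mem b he hYl))
    have h2 : omega b e (word Y) ∈ (semiPerfectSpan H ι n).map (omega b e).toLinearMap :=
      Submodule.mem_map_of_mem (f := (omega b e).toLinearMap)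
        (Submodule.subset_span ⟨Y, ⟨hY, hYl.length_eq ▸ hn⟩, rfl⟩)
    simpa using add_mem h1 h2

/-- The normal form of a monomial is the equivalent semi-perfect monomial, up to terms of lower
degree. -/
theorem exists_isNormalForm_word
    (he : ∀ α : Root H, e α ∈ LieAlgebra.rootSpace H α.1 ∧ e α ≠ 0) {X Y : List (Gen H ι)}
    (hY : IsSemiPerfect Y) (h : (expand Y).Perm (expand X)) :
    ∃ n ∈ semiPerfectSpan H ι (expand X).length,
      IsNormalForm b e (omega b e (word X)) (word Y + n) := by
  obtain ⟨n, hn, hn'⟩ := weightSpan_le_map_semiPerfectSpan b he _ (listProd_sub_omega_mem b he h)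
  refine ⟨n, hn, add_mem (Submodule.subset_span ⟨Y, hY, rfl⟩) (semiPerfectSpan_le _ hn), ?_⟩
  rw [AlgHom.toLinearMap_apply] at hn'
  rw [map_add, hn', omega_word b X]
  abel

/-- Different semi-perfect words expand to lists that are not permutations of each other, so their
images are independent; `ad` is faithful because `L` is simple. -/
theorem eq_zero_of_omega_eq_zero
    (he : ∀ α : Root H, e α ∈ LieAlgebra.rootSpace H α.1 ∧ e α ≠ 0)
    {n : FreeAlgebra ℂ (Gen H ι)}
    (hn : n ∈ Submodule.span ℂ (word '' {Y : List (Gen H ι) | IsSemiPerfect Y}))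
    (h0 : omega b e n = 0) : n = 0 := by
  have had : Function.Injective (LieAlgebra.ad ℂ L) := by
    rw [← LieHom.ker_eq_bot]
    exact LieAlgebra.ad_ker_eq_bot_of_hasTrivialRadical ℂ L
  have hlin := linearIndependent_listProd had _ (linearIndependent_letterVector b he)
    (fun Y : {Y : List (Gen H ι) | IsSemiPerfect Y} => expand Y.1)
    fun s t h => Subtype.ext (IsSemiPerfect.eq_of_perm s.2 t.2 h)
  rw [Set.image_eq_range] at hn
  obtain ⟨f, rfl⟩ := (Finsupp.mem_span_range_iff_exists_finsupp).1 hn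
  have hf : f = 0 := by
    refine linearIndependent_iff.1 hlin f ?_
    rw [← h0, Finsupp.linearCombination_apply, Finsupp.sum, Finsupp.sum, map_sum]
    refine Finset.sum_congr rfl fun Y _ => ?_
    rw [map_smul, omega_word]
  simp [hf]

theorem IsNormalForm.eq
    (he : ∀ α : Root H, e α ∈ LieAlgebra.rootSpace H α.1 ∧ e α ≠ 0)
    {x : UniversalEnvelopingAlgebra ℂ L} {m n : FreeAlgebra ℂ (Gen H ι)}
    (hm : IsNormalForm b e x m) (hn : IsNormalForm b e x n) : m = n :=
  sub_eq_zero.1 <| eq_zero_of_omega_eq_zero b he (sub_mem hm.1 hn.1) <| by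
    rw [map_sub, hm.2, hn.2, sub_self]

theorem exists_isNormalForm
    (he : ∀ α : Root H, e α ∈ LieAlgebra.rootSpace H α.1 ∧ e α ≠ 0)
    {x : UniversalEnvelopingAlgebra ℂ L} (hx : x ∈ cartanCentralizer H) :
    ∃ n, IsNormalForm (ι := ι) b e x n := by
  obtain ⟨k, hk⟩ := mem_weightSpan_of_mem_cartanCentralizer b he hx
  obtain ⟨n, hn, rfl⟩ := weightSpan_le_map_semiPerfectSpan b he _ hk
  exact ⟨n, semiPerfectSpan_le _ hn, rfl⟩

theorem range_omega (he : ∀ α : Root H, e α ∈ LieAlgebra.rootSpace H α.1 ∧ e α ≠ 0) :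
    (omega (ι := ι) b e).range = cartanCentralizer H := by
  refine le_antisymm ?_ fun x hx => ?_
  · rintro _ ⟨x, rfl⟩
    exact omega_mem_cartanCentralizer b he x
  · obtain ⟨n, -, hn⟩ := exists_isNormalForm b he hx
    exact ⟨n, hn⟩

end NormalForms

end CartanCentralizer

namespace CartanCentralizer

/-! ### Rewriting modulo the short relations -/

section Presentation

variable {L : Type*} [LieRing L] [LieAlgebra ℂ L] [FiniteDimensional ℂ L]
  {H : LieSubalgebra ℂ L} [H.IsCartanSubalgebra] {ι : Type*}
  [LinearOrder (Root H)] (I : TwoSidedIdeal (FreeAlgebra ℂ (Gen H ι)))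

/-- A two-sided ideal of the free algebra, as a subspace. -/
noncomputable def idealSubmodule : Submodule ℂ (FreeAlgebra ℂ (Gen H ι)) where
  carrier := I
  add_mem' := I.add_mem
  zero_mem' := I.zero_mem
  smul_mem' c x hx := by
    rw [Algebra.smul_def]
    exact I.mul_mem_left _ _ hx

/-- The elements of the free algebra that have degree less than `n` modulo the ideal `I`. -/
noncomputable def degreeLT (n : ℕ) : Submodule ℂ (FreeAlgebra ℂ (Gen H ι)) :=
  idealSubmodule I ⊔ Submodule.span ℂ (word '' {X : List (Gen H ι) | (expand X).length < n})

variable {I}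

theorem mem_degreeLT_of_mem {x : FreeAlgebra ℂ (Gen H ι)} (hx : x ∈ I) (n : ℕ) :
    x ∈ degreeLT I n :=
  Submodule.mem_sup_left hx

theorem word_mul_mul_word_mem_degreeLT {n : ℕ} {x : FreeAlgebra ℂ (Gen H ι)}
    (hx : x ∈ degreeLT I n) (X Y : List (Gen H ι)) :
    word X * x * word Y ∈ degreeLT I ((expand X).length + n + (expand Y).length) := by
  obtain ⟨i, hi, s, hs, rfl⟩ := Submodule.mem_sup.1 hx
  rw [mul_add, add_mul]
  refine add_mem (mem_degreeLT_of_mem (I.mul_mem_right _ _ (I.mul_mem_left _ _ hi)) _)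
    (Submodule.mem_sup_right ?_)
  have := Submodule.mem_map_of_mem
    (f := LinearMap.mulRight ℂ (word Y) ∘ₗ LinearMap.mulLeft ℂ (word X)) hs
  rw [Submodule.map_span] at this
  refine Submodule.span_mono ?_ this
  rintro _ ⟨_, ⟨Z, hZ, rfl⟩, rfl⟩
  refine ⟨X ++ Z ++ Y, ?_, by simp [word_append, mul_assoc]⟩
  rw [Set.mem_ofPred_eq] at hZ ⊢
  simp
  omega

theorem word_mul_mem_degreeLT {n : ℕ} {x : FreeAlgebra ℂ (Gen H ι)}
    (hx : x ∈ degreeLT I n) (X : List (Gen H ι)) :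
    word X * x ∈ degreeLT I ((expand X).length + n) := by
  simpa using word_mul_mul_word_mem_degreeLT hx X []

theorem mul_word_mem_degreeLT {n : ℕ} {x : FreeAlgebra ℂ (Gen H ι)}
    (hx : x ∈ degreeLT I n) (X : List (Gen H ι)) :
    x * word X ∈ degreeLT I (n + (expand X).length) := by
  simpa using word_mul_mul_word_mem_degreeLT hx [] X

/-- If generators commute up to lower degree, then all reorderings are equal up to lower degree. -/
theorem word_sub_word_mem_degreeLT_of_perm
    (hcomm : ∀ g g' : Gen H ι, word [g, g'] - word [g', g] ∈ degreeLT I (expand [g, g']).length)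
    {X Y : List (Gen H ι)} (h : X.Perm Y) :
    word X - word Y ∈ degreeLT I (expand X).length := by
  induction h with
  | nil => simp
  | @cons g X Y _ ih =>
    rw [word_cons, word_cons g Y, ← mul_sub]
    simpa using word_mul_mem_degreeLT ih [g]
  | swap g g' X =>
    have := mul_word_mem_degreeLT (hcomm g' g) X
    rw [sub_mul, ← word_append, ← word_append, ← List.length_append, ← expand_append] at this
    exact this
  | trans h1 _ ih1 ih2 =>
    rw [← (expand_perm h1).length_eq] at ih2
    simpa using add_mem ih1 ih2

variable [LinearOrder (Gen H ι)]

theorem semiPerfectSpan_le_degreeLT (n : ℕ) : semiPerfectSpan H ι n ≤ degreeLT I n :=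
  le_trans (Submodule.span_mono (Set.image_mono fun _ h => h.2)) le_sup_right

/-- The rewriting argument: if the generators commute up to lower degree, and if short monomials in
`J` agree with their semi-perfect forms up to lower degree, then so do all monomials. -/
theorem word_sub_word_mem_degreeLT
    [Finite ι]
    (hcomm : ∀ g g' : Gen H ι, word [g, g'] - word [g', g] ∈ degreeLT I (expand [g, g']).length)
    (hshort : ∀ X Y : List (Gen H ι), X.length ≤ maxDegree H → (∀ g ∈ X, g ∈ Set.range Gen.c) →
      IsSemiPerfect Y → (expand Y).Perm (expand X) →
      word X - word Y ∈ degreeLT I (expand X).length)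
    {X Y : List (Gen H ι)} (hY : IsSemiPerfect Y) (h : (expand Y).Perm (expand X)) :
    word X - word Y ∈ degreeLT I (expand X).length := by
  induction hn : (expand X).length using Nat.strong_induction_on generalizing X Y with
  | _ n ih =>
  subst hn
  cases Y with
  | nil =>
    rw [eq_nil_of_expand_eq_nil h.symm.eq_nil, sub_self]
    exact zero_mem _
  | cons g Y =>
    -- It suffices to reach any word with the right head `g`: the tail has fewer letters, so
    -- induction carries it to `Y`, which is again semi-perfect.
    have step : ∀ V : List (Gen H ι), (expand V).Perm (expand Y) →
        word X - word (g :: V) ∈ degreeLT I (expand X).length →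
        word X - word (g :: Y) ∈ degreeLT I (expand X).length := by
      intro V hV hXV
      have hg := List.length_pos_iff.2 g.letters_ne_nil
      have hlen := h.length_eq
      have hlenV := hV.length_eq
      rw [expand_cons, List.length_append] at hlen
      have h1 := word_mul_mem_degreeLT (ih _ (by omega) hY.of_cons hV.symm rfl) [g]
      rw [mul_sub, ← word_cons, ← word_cons, expand_cons, expand_nil, List.append_nil, hlenV,
        hlen] at h1
      simpa using add_mem hXV h1
    cases g with
    | h i =>
      have hi : Sum.inl i ∈ expand X := h.subset (by simp [Gen.letters])
      obtain ⟨g, hgX, hg⟩ := List.mem_flatMap.1 hi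
      have hgi : g = .h i := by
        cases g with
        | h j => simpa [Gen.letters, eq_comm] using hg
        | c p => simp [Gen.letters] at hg
      subst hgi
      obtain ⟨V₁, V₂, rfl⟩ := List.append_of_mem hgX
      have hV : (V₁ ++ .h i :: V₂).Perm (.h i :: (V₁ ++ V₂)) := List.perm_middle
      refine step (V₁ ++ V₂) ?_ (word_sub_word_mem_degreeLT_of_perm hcomm hV)
      exact (List.perm_append_left_iff _).1 ((expand_perm hV).symm.trans h.symm)
    | c p =>
      obtain ⟨X₁, X₂, W, hX, hne, hlen, hJ, hW⟩ := exists_perm_append_of_perm_cons p h.symm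
      obtain ⟨Z, hZ, hZX⟩ := exists_isSemiPerfect X₁
      -- The factors covering `p` are moved to the front and replaced by their semi-perfect form,
      -- using one short relation.
      have hXZ : word X - word (Z ++ X₂) ∈ degreeLT I (expand X).length := by
        have h1 := word_sub_word_mem_degreeLT_of_perm hcomm hX
        have h2 := mul_word_mem_degreeLT (hshort X₁ Z hlen hJ hZ hZX) X₂
        rw [sub_mul, ← word_append, ← word_append, ← List.length_append, ← expand_append,
          ← (expand_perm hX).length_eq] at h2
        simpa using add_mem h1 h2
      have hZX' : (expand (Z ++ X₂)).Perm (expand X) := by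
        rw [expand_append]
        refine (hZX.append_right _).trans ?_
        rw [← expand_append]
        exact (expand_perm hX).symm
      cases Z with
      | nil => exact absurd (eq_nil_of_expand_eq_nil hZX.symm.eq_nil) hne
      | cons g Z =>
        -- A smaller head would contradict the minimality of the semi-perfect form of `X`; a larger
        -- one that of the form of `X₁`, since `c p :: W` has the same letters as `X₁`.
        have hg : g = .c p := by
          rcases lt_trichotomy g (.c p) with hlt | heq | hlt
          · exact absurd (LexLT.of_lt hlt _ _) (hY (g :: Z ++ X₂) (hZX'.trans h.symm))
          · exact heq
          · exact absurd (LexLT.of_lt hlt _ _) (hZ (.c p :: W) (hW.symm.trans hZX.symm))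
        subst hg
        exact step (Z ++ X₂) ((List.perm_append_left_iff _).1 (hZX'.trans h.symm)) hXZ

theorem mem_idealSubmodule_sup_span [Finite ι]
    (hred : ∀ X Y : List (Gen H ι), IsSemiPerfect Y → (expand Y).Perm (expand X) →
      word X - word Y ∈ degreeLT I (expand X).length)
    (x : FreeAlgebra ℂ (Gen H ι)) :
    x ∈ idealSubmodule I ⊔
      Submodule.span ℂ (word '' {Y : List (Gen H ι) | IsSemiPerfect Y}) := by
  have hword : ∀ (n : ℕ) (X : List (Gen H ι)), (expand X).length = n →
      word X ∈ idealSubmodule I ⊔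
        Submodule.span ℂ (word '' {Y : List (Gen H ι) | IsSemiPerfect Y}) := by
    intro n
    induction n using Nat.strong_induction_on with
    | _ n ih =>
      rintro X rfl
      obtain ⟨Y, hY, hYX⟩ := exists_isSemiPerfect X
      have hle : degreeLT I (expand X).length ≤ idealSubmodule I ⊔
          Submodule.span ℂ (word '' {Y : List (Gen H ι) | IsSemiPerfect Y}) := by
        refine sup_le le_sup_left (Submodule.span_le.2 ?_)
        rintro _ ⟨Z, hZ, rfl⟩
        exact ih _ hZ Z rfl
      have h1 := hle (hred X Y hY hYX)
      have h2 : word Y ∈ idealSubmodule I ⊔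
          Submodule.span ℂ (word '' {Y : List (Gen H ι) | IsSemiPerfect Y}) :=
        Submodule.mem_sup_right (Submodule.subset_span ⟨Y, hY, rfl⟩)
      simpa using add_mem h1 h2
  have hx : x ∈ Submodule.span ℂ (Set.range (word (H := H) (ι := ι))) :=
    by rw [span_range_word]; exact Submodule.mem_top
  refine Submodule.span_le.2 ?_ hx
  rintro _ ⟨X, rfl⟩
  exact hword _ X rfl

variable (b : Module.Basis ι ℂ H) {e : Root H → L}

theorem shortRelations_subset_ker (A : Set (Gen H ι)) :
    shortRelations b e A ⊆ TwoSidedIdeal.ker (omega b e) := by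
  rintro _ ⟨X, n, -, -, hn, rfl⟩
  refine (TwoSidedIdeal.mem_ker _).2 ?_
  rw [map_sub, hn.2, sub_self]

variable [LieAlgebra.IsSimple ℂ L]

/-- The normal form of `X` has leading term `word Y` and otherwise only lower degree, so the
relation itself is the required congruence. -/
theorem word_sub_word_mem_degreeLT_of_shortRelations
    (he : ∀ α : Root H, e α ∈ LieAlgebra.rootSpace H α.1 ∧ e α ≠ 0) {A : Set (Gen H ι)}
    (hI : shortRelations b e A ⊆ I) {X Y : List (Gen H ι)} (hX : X.length ≤ maxDegree H)
    (hA : ∀ g ∈ X, g ∈ A) (hY : IsSemiPerfect Y) (h : (expand Y).Perm (expand X)) :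
    word X - word Y ∈ degreeLT I (expand X).length := by
  obtain ⟨n, hn, hn'⟩ := exists_isNormalForm_word b he hY h
  have h1 : word X - (word Y + n) ∈ degreeLT I (expand X).length :=
    mem_degreeLT_of_mem (hI ⟨X, _, hX, hA, hn', rfl⟩) _
  have := add_mem h1 (semiPerfectSpan_le_degreeLT _ hn)
  rwa [sub_add_eq_sub_sub, sub_add_cancel] at this

/-- Modulo `I` an element of the kernel becomes a combination of semi-perfect words, still in the
kernel because `I` is, hence zero. -/
theorem ker_omega_le (he : ∀ α : Root H, e α ∈ LieAlgebra.rootSpace H α.1 ∧ e α ≠ 0)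
    (hI : shortRelations b e (Set.range Gen.c) ⊆ I) (hI' : centralRelations H ι ⊆ I)
    (hker : I ≤ TwoSidedIdeal.ker (omega b e)) : TwoSidedIdeal.ker (omega b e) ≤ I := by
  have : Finite ι := Module.Finite.finite_basis b
  have hshort := fun (X Y : List (Gen H ι)) hX hA hY h =>
    word_sub_word_mem_degreeLT_of_shortRelations (X := X) (Y := Y) b he hI hX hA hY h
  have hcomm : ∀ g g' : Gen H ι,
      word [g, g'] - word [g', g] ∈ degreeLT I (expand [g, g']).length := by
    intro g g'
    cases g with
    | h i => exact mem_degreeLT_of_mem (hI' ⟨i, g', rfl⟩) _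
    | c p =>
      cases g' with
      | h i =>
        rw [← neg_sub]
        exact neg_mem (mem_degreeLT_of_mem (hI' ⟨i, .c p, rfl⟩) _)
      | c q =>
        -- Both orders of the two generators reduce to the same semi-perfect word by relations of
        -- length two.
        obtain ⟨Y, hY, hYX⟩ := exists_isSemiPerfect [Gen.c (ι := ι) p, .c q]
        have hswap : (expand [Gen.c (ι := ι) p, .c q]).Perm (expand [.c q, .c p]) :=
          expand_perm (List.Perm.swap _ _ _)
        have hJ : ∀ g ∈ [Gen.c (ι := ι) p, .c q], g ∈ Set.range (Gen.c (H := H) (ι := ι)) := by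
          intro g hg
          rcases List.mem_pair.1 hg with rfl | rfl <;> exact ⟨_, rfl⟩
        have h1 := hshort [.c p, .c q] Y (two_le_maxDegree b he) hJ hY hYX
        have h2 := hshort [.c q, .c p] Y (two_le_maxDegree b he)
          (fun g hg => hJ g (List.mem_pair.2 (List.mem_pair.1 hg).symm)) hY (hYX.trans hswap)
        rw [← hswap.length_eq] at h2
        simpa using sub_mem h1 h2
  intro x hx
  obtain ⟨i, hi, s, hs, rfl⟩ := Submodule.mem_sup.1 <| mem_idealSubmodule_sup_span
    (fun X Y hY h => word_sub_word_mem_degreeLT (X := X) (Y := Y) hcomm hshort hY h) x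
  have hi0 := (TwoSidedIdeal.mem_ker _).1 (hker hi)
  have hx0 := (TwoSidedIdeal.mem_ker _).1 hx
  rw [map_add, hi0, zero_add] at hx0
  rw [eq_zero_of_omega_eq_zero b he hs hx0, add_zero]
  exact hi

theorem ker_omega_eq_span_union
    (he : ∀ α : Root H, e α ∈ LieAlgebra.rootSpace H α.1 ∧ e α ≠ 0) :
    TwoSidedIdeal.ker (omega (ι := ι) b e) =
      TwoSidedIdeal.span (shortRelations b e (Set.range Gen.c) ∪ centralRelations H ι) := by
  have hle : TwoSidedIdeal.span (shortRelations b e (Set.range Gen.c) ∪ centralRelations H ι) ≤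
      TwoSidedIdeal.ker (omega (ι := ι) b e) :=
    TwoSidedIdeal.span_le.2 <|
      Set.union_subset (shortRelations_subset_ker b _) (centralRelations_subset_ker b he)
  exact le_antisymm (ker_omega_le b he
    (Set.subset_union_left.trans TwoSidedIdeal.subset_span)
    (Set.subset_union_right.trans TwoSidedIdeal.subset_span) hle) hle

theorem ker_omega_eq_span
    (he : ∀ α : Root H, e α ∈ LieAlgebra.rootSpace H α.1 ∧ e α ≠ 0) :
    TwoSidedIdeal.ker (omega (ι := ι) b e) =
      TwoSidedIdeal.span (shortRelations b e Set.univ) := by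
  refine le_antisymm ?_ (TwoSidedIdeal.span_le.2 (shortRelations_subset_ker b _))
  rw [ker_omega_eq_span_union b he, TwoSidedIdeal.span_le]
  refine Set.union_subset ?_ ?_
  · rintro _ ⟨X, n, hX, -, hn, rfl⟩
    exact TwoSidedIdeal.subset_span ⟨X, n, hX, fun _ _ => trivial, hn, rfl⟩
  · rintro _ ⟨i, g, rfl⟩
    -- A central relation is the difference of two relations of length two with a common normal
    -- form.
    obtain ⟨n, hn⟩ := exists_isNormalForm b he
      (omega_mem_cartanCentralizer b he (word [Gen.h i, g]))
    have hn' := hn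
    rw [omega_word_comm b he] at hn'
    have h1 : word [Gen.h i, g] - n ∈ TwoSidedIdeal.span (shortRelations b e Set.univ) :=
      TwoSidedIdeal.subset_span
        ⟨[.h i, g], n, two_le_maxDegree b he, fun _ _ => trivial, hn, rfl⟩
    have h2 : word [g, Gen.h i] - n ∈ TwoSidedIdeal.span (shortRelations b e Set.univ) :=
      TwoSidedIdeal.subset_span
        ⟨[g, .h i], n, two_le_maxDegree b he, fun _ _ => trivial, hn', rfl⟩
    simpa using TwoSidedIdeal.sub_mem _ h1 h2

theorem finite_shortRelations (he : ∀ α : Root H, e α ∈ LieAlgebra.rootSpace H α.1 ∧ e α ≠ 0)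
    (A : Set (Gen H ι)) : (shortRelations b e A).Finite := by
  have : Finite ι := Module.Finite.finite_basis b
  -- Uniqueness of normal forms makes a relation depend only on its word, and there are finitely
  -- many words of length at most `d₀`.
  choose N hN using fun X : List (Gen H ι) =>
    exists_isNormalForm (ι := ι) b he (omega_mem_cartanCentralizer b he (word X))
  refine ((List.finite_length_le (Gen H ι) (maxDegree H)).image fun X => word X - N X).subset ?_
  rintro _ ⟨X, n, hX, -, hn, rfl⟩
  exact ⟨X, hX, by rw [hn.eq b he (hN X)]⟩

end Presentation

/-! ### Finite presentation, by transport to generators indexed by `Fin n` -/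

theorem isFinitelyPresented_of_finite {σ A : Type*} [Finite σ] [Ring A] [Algebra ℂ A]
    (f : FreeAlgebra ℂ σ →ₐ[ℂ] A) (hf : Function.Surjective f) {R : Set (FreeAlgebra ℂ σ)}
    (hR : R.Finite) (hker : TwoSidedIdeal.ker f = TwoSidedIdeal.span R) :
    IsFinitelyPresented A := by
  classical
  obtain ⟨n, ⟨ε⟩⟩ := Finite.exists_equiv_fin σ
  obtain ⟨φ⟩ : Nonempty (FreeAlgebra ℂ (Fin n) ≃ₐ[ℂ] FreeAlgebra ℂ σ) :=
    ⟨AlgEquiv.ofAlgHom (FreeAlgebra.lift ℂ fun i => FreeAlgebra.ι ℂ (ε.symm i))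
      (FreeAlgebra.lift ℂ fun s => FreeAlgebra.ι ℂ (ε s)) (by ext; simp) (by ext; simp)⟩
  have hmem : ∀ z, z ∈ TwoSidedIdeal.ker (f.comp φ.toAlgHom) ↔ φ z ∈ TwoSidedIdeal.ker f :=
    fun z => by rw [TwoSidedIdeal.mem_ker, TwoSidedIdeal.mem_ker]; rfl
  refine ⟨n, f.comp φ.toAlgHom, hR.toFinset.image φ.symm, hf.comp φ.surjective, ?_⟩
  rw [Finset.coe_image, Set.Finite.coe_toFinset]
  refine le_antisymm (fun z hz => ?_) (TwoSidedIdeal.span_le.2 ?_)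
  · have h2 : TwoSidedIdeal.span R ≤ TwoSidedIdeal.comap (φ.symm : _ →+* FreeAlgebra ℂ (Fin n))
        (TwoSidedIdeal.span (φ.symm '' R)) :=
      TwoSidedIdeal.span_le.2 fun r hr =>
        (TwoSidedIdeal.mem_comap _).2 (TwoSidedIdeal.subset_span ⟨r, hr, rfl⟩)
    rw [hmem, hker] at hz
    have h3 : φ.symm (φ z) ∈ TwoSidedIdeal.span (φ.symm '' R) :=
      (TwoSidedIdeal.mem_comap _).1 (h2 hz)
    rwa [AlgEquiv.symm_apply_apply] at h3
  · rintro _ ⟨r, hr, rfl⟩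
    rw [SetLike.mem_coe, hmem, AlgEquiv.apply_symm_apply, hker]
    exact TwoSidedIdeal.subset_span hr

theorem IsFinitelyPresented.finiteType {A : Type*} [Ring A] [Algebra ℂ A]
    (h : IsFinitelyPresented A) : Algebra.FiniteType ℂ A := by
  obtain ⟨n, f, -, hf, -⟩ := h
  have : Algebra.FiniteType ℂ (FreeAlgebra ℂ (Fin n)) := inferInstance
  exact this.of_surjective f hf

end CartanCentralizer

open CartanCentralizer in
theorem theorem2 {L : Type*} [LieRing L] [LieAlgebra ℂ L] [FiniteDimensional ℂ L]
    [LieAlgebra.IsSimple ℂ L] (H : LieSubalgebra ℂ L) [H.IsCartanSubalgebra]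
    {ι : Type*} (b : Module.Basis ι ℂ H)
    (e : Root H → L) (he : ∀ α : Root H, e α ∈ LieAlgebra.rootSpace H α.1 ∧ e α ≠ 0)
    [LinearOrder (Root H)] [LinearOrder (Gen H ι)] :
    -- there are finitely many indecomposable lists, hence finitely many perfect monomials
    {s : Multiset (Root H) | IsIndecomposable s}.Finite ∧
    -- the perfect monomials generate the Cartan centralizer
    (omega (ι := ι) b e).range = cartanCentralizer H ∧
    -- every element of the Cartan centralizer has exactly one normal form
    (∀ x ∈ cartanCentralizer H, ∃! n, IsNormalForm (ι := ι) b e x n) ∧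
    -- modulo the centrality of the Cartan generators, the ideal of relations is generated by
    -- the relations of length at most `d₀` on the non-Cartan generators
    TwoSidedIdeal.ker (omega (ι := ι) b e) =
      TwoSidedIdeal.span (shortRelations b e (Set.range Gen.c) ∪ centralRelations H ι) ∧
    -- the ideal of relations is generated by the relations of length at most `d₀`
    -- on all the generators
    TwoSidedIdeal.ker (omega (ι := ι) b e) =
      TwoSidedIdeal.span (shortRelations b e Set.univ) ∧
    Algebra.FiniteType ℂ (cartanCentralizer H) ∧
    IsFinitelyPresented (cartanCentralizer H) := by
  have : Finite ι := Module.Finite.finite_basis b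
  let f : FreeAlgebra ℂ (Gen H ι) →ₐ[ℂ] cartanCentralizer H :=
    (omega b e).codRestrict _ (omega_mem_cartanCentralizer b he)
  have hf : Function.Surjective f := by
    rintro ⟨x, hx⟩
    rw [← range_omega (ι := ι) b he] at hx
    obtain ⟨n, hn⟩ := hx
    exact ⟨n, Subtype.ext hn⟩
  have hker : TwoSidedIdeal.ker f = TwoSidedIdeal.span (shortRelations b e Set.univ) := by
    rw [← ker_omega_eq_span b he]
    ext x
    rw [TwoSidedIdeal.mem_ker, TwoSidedIdeal.mem_ker, ← Subtype.val_inj]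
    rfl
  have hfp : IsFinitelyPresented (cartanCentralizer H) :=
    isFinitelyPresented_of_finite f hf (finite_shortRelations b he _) hker
  refine ⟨finite_isIndecomposable, range_omega b he, fun x hx => ?_, ker_omega_eq_span_union b he,
    ker_omega_eq_span b he, hfp.finiteType, hfp⟩
  obtain ⟨n, hn⟩ := exists_isNormalForm (ι := ι) b he hx
  exact ⟨n, hn, fun m hm => hm.eq b he hn⟩
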